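/- Let $\mathcal A$ be a finite discrete set and let $\sigma:\mathcal A^{\mathbb Z}\to\mathcal A^{\mathbb Z}$, $\sigma(\mathbf a)_z=a_{z-1}$, be the shift. Let $\mathcal A^{\mathbb Z}$ (with the product topology) carry a topological group structure $\bullet$, not necessarily componentwise, for which $\sigma$ is a group automorphism. Let $\Phi:\mathcal A^{\mathbb Z}\to\mathcal A^{\mathbb Z}$ be a group endomorphism that is a bipermutative cellular automaton: there are $\ell,r\ge 0$ and a local rule $\phi:\mathcal A^{[-\ell..r]}\to\mathcal A$ with $\Phi(\mathbf a)_z=\phi(a_{z-\ell},\dots,a_{z+r})$ for all $\mathbf a$ and $z$, such that $\phi$ is bijective in its leftmost argument when all the others are fixed, and bijective in its rightmost argument when all the others are fixed. Let $\mu$ be a Borel probability measure on $\mathcal A^{\mathbb Z}$ that is $\Phi$-invariant and totally $\sigma$-ergodic (i.e. $\sigma^n$-ergodic for every $n\ge1$). Let $\mathfrak B$ be the Borel $\sigma$-algebra, let $\mu_{\mathbf x}$ be the fibre measures, i.e. the regular conditional probabilities of $\mu$ given $\Phi^{-1}(\mathfrak B)$, and put $$\mathcal E(\mathbf x)=\{\mathbf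 y:\ \Phi(\mathbf y)=\Phi(\mathbf x),\ \mu_{\mathbf y}\{\mathbf y\}>0\}.$$ Then there is a finite subgroup $\mathcal J\subseteq\ker\Phi$ with $\sigma^{-1}(\mathcal J)=\mathcal J$ such that: (i) for $\mu$-almost every $\mathbf x$, $\ \mathcal E(\mathbf x)=\operatorname{supp}(\mu_{\mathbf x})=\mathbf x\bullet\mathcal J$; (ii) the Kolmogorov–Sinai entropy satisfies $h_\mu(\Phi)=\log|\mathcal J|$ (the same base of logarithm being used on both sides); (iii) $\Phi$ is $|\mathcal J|$-to-1 $\mu$-almost everywhere: there is a measurable set $\mathcal U$ with $\mu(\mathcal U)=1$, $\ \mu(\Phi^{-1}(\mathcal U)\,\triangle\,\mathcal U)=0$, and $|\mathcal U\cap\Phi^{-1}\{\mathbf u\}|=|\mathcal J|$ for $\mu$-almost every $\mathbf u\in\mathcal U$. -/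

import Mathlib

open MeasureTheory ProbabilityTheory Filter

namespace BipermCA

/-- The shift on `A^ℤ`: `shift a` is the sequence `b` with `b_z = a_{z-1}`. -/
def shift {A : Type*} (a : ℤ → A) : ℤ → A := fun z => a (z - 1)

/-- The map on `A^ℤ` with local rule `φ : A^{[-ℓ..r]} → A`, that is
`Φ(a)_z = φ(a_{z-ℓ}, …, a_{z+r})`; the window is indexed by `Fin (ℓ + r + 1)`. -/
def ofLocalRule {A : Type*} (ℓ r : ℕ) (φ : (Fin (ℓ + r + 1) → A) → A) (a : ℤ → A) : ℤ → A :=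
  fun z => φ (fun i => a (z - (ℓ : ℤ) + ((i : ℕ) : ℤ)))

/-- The rule is a bijection in its rightmost argument, the other ones being fixed. -/
def RightPermutative {A : Type*} {n : ℕ} (φ : (Fin (n + 1) → A) → A) : Prop :=
  ∀ a : Fin n → A, Function.Bijective fun b : A => φ (Fin.snoc (α := fun _ => A) a b)

/-- The rule is a bijection in its leftmost argument, the other ones being fixed. -/
def LeftPermutative {A : Type*} {n : ℕ} (φ : (Fin (n + 1) → A) → A) : Prop :=
  ∀ b : Fin n → A, Function.Bijective fun a : A => φ (Fin.cons (α := fun _ => A) a b)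

/-- `Φ` is a bipermutative cellular automaton: it is given by a local rule on a window
`[-ℓ..r]` with `ℓ, r ≥ 0` that is both left- and right-permutative. -/
def IsBipermutativeCA {A : Type*} (Φ : (ℤ → A) → (ℤ → A)) : Prop :=
  ∃ (ℓ r : ℕ) (φ : (Fin (ℓ + r + 1) → A) → A),
    Φ = ofLocalRule ℓ r φ ∧ LeftPermutative φ ∧ RightPermutative φ

/-- `A^ℤ` with the given multiplication is a group shift: a topological group on which the
(bijective) shift map is a group automorphism. The group structure need not be the
componentwise one. -/
structure IsGroupShift (A : Type*) [TopologicalSpace A] [Group (ℤ → A)] : Prop where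
  isTopologicalGroup : IsTopologicalGroup (ℤ → A)
  shift_mul : ∀ x y : ℤ → A, shift (x * y) = shift x * shift y

/-- `μ` is totally `T`-ergodic: it is `T^n`-ergodic for every `n ≥ 1`. -/
def TotallyErgodic {Ω : Type*} [MeasurableSpace Ω] (T : Ω → Ω) (μ : Measure Ω) : Prop :=
  ∀ n : ℕ, 1 ≤ n → Ergodic (T^[n]) μ

/-- Shannon entropy `-∑ μ(P_i) log μ(P_i)` of the finite partition into the level sets
`P_i = {f = i}`. -/
noncomputable def partitionEntropy {Ω ι : Type*} [MeasurableSpace Ω] [Fintype ι]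
    (μ : Measure Ω) (f : Ω → ι) : ℝ :=
  ∑ i : ι, Real.negMulLog (μ.real (f ⁻¹' {i}))

/-- The partition `⋁_{t < n} T^{-t} 𝒫`, where `𝒫` is the partition into level sets of `f`. -/
def itinerary {Ω ι : Type*} (T : Ω → Ω) (f : Ω → ι) (n : ℕ) : Ω → (Fin n → ι) :=
  fun ω t => f (T^[(t : ℕ)] ω)

/-- `h_μ(T, 𝒫) = lim_n (1/n) H_μ(⋁_{t < n} T^{-t} 𝒫)`; the limit exists for invariant `μ`. -/
noncomputable def entropyOfPartition {Ω ι : Type*} [MeasurableSpace Ω] [Fintype ι]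
    (T : Ω → Ω) (μ : Measure Ω) (f : Ω → ι) : EReal :=
  limsup (fun n : ℕ => ((partitionEntropy μ (itinerary T f n) / (n : ℝ) : ℝ) : EReal)) atTop

/-- Kolmogorov–Sinai entropy: the supremum of `h_μ(T, 𝒫)` over all finite measurable
partitions `𝒫`. -/
noncomputable def entropy {Ω : Type*} [MeasurableSpace Ω] (T : Ω → Ω) (μ : Measure Ω) : EReal :=
  ⨆ (k : ℕ) (f : Ω → Fin k) (_ : Measurable f), entropyOfPartition T μ f

/-- The fibre measure `μ_x`: the regular conditional probability of `μ` given the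
sigma-algebra `Φ⁻¹(𝔅)`, at the point `x`. -/
noncomputable def fibreMeasure {Ω : Type*} [mΩ : MeasurableSpace Ω] [StandardBorelSpace Ω]
    (Φ : Ω → Ω) (μ : Measure Ω) [IsFiniteMeasure μ] (x : Ω) : Measure Ω :=
  condExpKernel μ (MeasurableSpace.comap Φ mΩ) x

/-- `ℰ(x) = {y ∈ Φ⁻¹{Φ(x)} : η(y) > 0}`, where `η(y) = μ_y{y}`. -/
def fibreAtoms {Ω : Type*} [MeasurableSpace Ω] [StandardBorelSpace Ω]
    (Φ : Ω → Ω) (μ : Measure Ω) [IsFiniteMeasure μ] (x : Ω) : Set Ω :=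
  {y | Φ y = Φ x ∧ 0 < fibreMeasure Φ μ y {y}}

/-- `Φ` is `K`-to-1 `μ`-almost everywhere: there is a set `U` of full measure with
`Φ⁻¹(U) = U` modulo `μ` such that almost every `u ∈ U` has exactly `K` preimages in `U`. -/
def IsAEToOne {Ω : Type*} [MeasurableSpace Ω] (Φ : Ω → Ω) (μ : Measure Ω) (K : ℕ) : Prop :=
  ∃ U : Set Ω, MeasurableSet U ∧ μ U = 1 ∧ Φ ⁻¹' U =ᵐ[μ] U ∧
    ∀ᵐ u ∂μ, u ∈ U → (U ∩ Φ ⁻¹' {u}).encard = (K : ℕ∞)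

end BipermCA

/-! Bipermutativity makes a point recoverable from its image and its word on `[-ℓ, r)`, so `ker Φ`
is finite. The shift permutes this kernel, hence some power `S` of it fixes the kernel pointwise,
and `S` is ergodic by total ergodicity. Right translation by a kernel element `k` then commutes with
`S`, so it carries `μ` to another `S`-ergodic measure, which is either `μ` or singular to `μ`
(`map_mul_eq_or_mutuallySingular`). The group `J` consists of the `k` of the first kind
(`kerStabilizer`). Singularity for the finitely many others yields one full-measure set `U` that
meets almost every fibre `x · ker Φ` exactly in `x · J`
(`exists_measurableSet_mem_iff_mem_kerStabilizer`). With the `J`-invariance of `μ`, this forces the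
fibre measures to be uniform on `x · J` (`condExp_comap_eq_average`), which gives (i), while `U`
itself witnesses (iii).

For the entropy, let `B m` be the Shannon entropy of a word of length `m`. A word on `[a - ℓ, b +
r)`, with `a ≤ 0 ≤ b`, carries the same information as the central word on `[-ℓ, r)` together with
the image word on `[a, b)`. So `B (m + ℓ + r) - B m` is the entropy of the central word given an
image word of length `m`. By martingale convergence it tends to the entropy given `Φ⁻¹(𝔅)`, which is
`log |J|`, because the central word separates the points of a fibre. Itineraries of length `n`
correspond to words of length about `n (ℓ + r)`, so `h_μ(Φ)` is this limit (`entropy_ofLocalRule`).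
-/

namespace BipermCA

/-! ### Shannon entropy and conditional entropy of finite partitions -/

section Shannon

open scoped Topology

variable {Ω : Type*} [mΩ : MeasurableSpace Ω] {μ : Measure Ω} [IsProbabilityMeasure μ]
  {α β γ : Type*} [Fintype α] [MeasurableSpace α] [MeasurableSingletonClass α]
  [Fintype β] [MeasurableSpace β] [MeasurableSingletonClass β]
  [Fintype γ] [MeasurableSpace γ] [MeasurableSingletonClass γ]

lemma integrable_comp_of_fintype {f : Ω → α} (hf : Measurable f) (φ : α → ℝ) :
    Integrable (fun x => φ (f x)) μ := by
  have : IsProbabilityMeasure (μ.map f) := Measure.isProbabilityMeasure_map hf.aemeasurable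
  have h : Integrable φ (μ.map f) := Integrable.of_finite
  exact h.comp_measurable hf

lemma integral_comp_of_fintype {f : Ω → α} (hf : Measurable f) (φ : α → ℝ) :
    ∫ x, φ (f x) ∂μ = ∑ i, μ.real (f ⁻¹' {i}) * φ i := by
  have : IsProbabilityMeasure (μ.map f) := Measure.isProbabilityMeasure_map hf.aemeasurable
  have h : Integrable φ (μ.map f) := Integrable.of_finite
  rw [← integral_map hf.aemeasurable h.aestronglyMeasurable, integral_fintype h]
  refine Finset.sum_congr rfl fun i _ => ?_
  rw [map_measureReal_apply hf (measurableSet_singleton i), smul_eq_mul]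

lemma partitionEntropy_eq_integral {f : Ω → α} (hf : Measurable f) :
    partitionEntropy μ f = ∫ x, -Real.log (μ.real (f ⁻¹' {f x})) ∂μ := by
  rw [integral_comp_of_fintype hf fun i => -Real.log (μ.real (f ⁻¹' {i}))]
  simp [partitionEntropy, Real.negMulLog]

lemma ae_measureReal_fiber_pos (f : Ω → α) :
    ∀ᵐ x ∂μ, 0 < μ.real (f ⁻¹' {f x}) := by
  have h : ∀ i, ∀ᵐ x ∂μ, f x = i → 0 < μ.real (f ⁻¹' {i}) := by
    intro i
    by_cases hi : μ (f ⁻¹' {i}) = 0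
    · have h' : ∀ᵐ x ∂μ, x ∉ f ⁻¹' {i} := measure_eq_zero_iff_ae_notMem.1 hi
      filter_upwards [h'] with x hx hxi using absurd hxi hx
    · exact Eventually.of_forall fun x _ => ENNReal.toReal_pos hi (measure_ne_top _ _)
  filter_upwards [ae_all_iff.2 h] with x hx using hx _ rfl

/-- Each cell of the finer partition lies in a cell of the coarser one, so the information functions
compare pointwise, off the null cells where the logarithm takes its default value. -/
lemma partitionEntropy_mono {f : Ω → α} {g : Ω → β} (hf : Measurable f) (hg : Measurable g)
    (h : ∀ x y, f x = f y → g x = g y) : partitionEntropy μ g ≤ partitionEntropy μ f := by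
  rw [partitionEntropy_eq_integral hf, partitionEntropy_eq_integral hg]
  refine integral_mono_ae
    (integrable_comp_of_fintype hg fun i => -Real.log (μ.real (g ⁻¹' {i})))
    (integrable_comp_of_fintype hf fun i => -Real.log (μ.real (f ⁻¹' {i}))) ?_
  filter_upwards [ae_measureReal_fiber_pos (μ := μ) f] with x hx
  exact neg_le_neg (Real.log_le_log hx (measureReal_mono fun y hy => h y x hy))

lemma partitionEntropy_congr {f : Ω → α} {g : Ω → β} (hf : Measurable f) (hg : Measurable g)
    (h : ∀ x y, f x = f y ↔ g x = g y) : partitionEntropy μ f = partitionEntropy μ g :=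
  le_antisymm (partitionEntropy_mono hg hf fun x y => (h x y).2)
    (partitionEntropy_mono hf hg fun x y => (h x y).1)

lemma partitionEntropy_comp {T : Ω → Ω} (hT : MeasurePreserving T μ μ) {f : Ω → α}
    (hf : Measurable f) : partitionEntropy μ (fun x => f (T x)) = partitionEntropy μ f := by
  refine Finset.sum_congr rfl fun i _ => ?_
  have : (fun x => f (T x)) ⁻¹' {i} = T ⁻¹' (f ⁻¹' {i}) := rfl
  rw [this, hT.measureReal_preimage (hf (measurableSet_singleton i)).nullMeasurableSet]

lemma sum_measureReal_inter_fiber {f : Ω → α} (hf : Measurable f) (s : Set Ω) :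
    ∑ i, μ.real (s ∩ f ⁻¹' {i}) = μ.real s := by
  have h := sum_measureReal_preimage_singleton (μ := μ.restrict s) (Finset.univ : Finset α)
    (f := f) (fun i _ => hf (measurableSet_singleton i))
  simp only [Finset.coe_univ, Set.preimage_univ, measureReal_restrict_apply MeasurableSet.univ,
    Set.univ_inter] at h
  rw [← h]
  refine Finset.sum_congr rfl fun i _ => ?_
  rw [measureReal_restrict_apply (hf (measurableSet_singleton i)), Set.inter_comm]

/-- Strong subadditivity of the Shannon entropy. -/
lemma partitionEntropy_submodular {f : Ω → α} {g : Ω → β} {h : Ω → γ}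
    (hf : Measurable f) (hg : Measurable g) (hh : Measurable h) :
    partitionEntropy μ (fun x => (f x, g x, h x)) + partitionEntropy μ g ≤
      partitionEntropy μ (fun x => (f x, g x)) + partitionEntropy μ (fun x => (g x, h x)) := by
  have hfg : Measurable fun x => (f x, g x) := hf.prodMk hg
  have hgh : Measurable fun x => (g x, h x) := hg.prodMk hh
  have hfgh : Measurable fun x => (f x, g x, h x) := hf.prodMk hgh
  set P : α → β → γ → ℝ := fun a b c => μ.real ((fun x => (f x, g x, h x)) ⁻¹' {(a, b, c)}) with hP
  set Q : α → β → ℝ := fun a b => μ.real ((fun x => (f x, g x)) ⁻¹' {(a, b)}) with hQ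
  set R : β → γ → ℝ := fun b c => μ.real ((fun x => (g x, h x)) ⁻¹' {(b, c)}) with hR
  set S : β → ℝ := fun b => μ.real (g ⁻¹' {b}) with hS
  have hQS : ∀ b, ∑ a, Q a b = S b := fun b => by
    simp only [hS]
    rw [← sum_measureReal_inter_fiber hf]
    refine Finset.sum_congr rfl fun a _ => ?_
    simp only [hQ]; congr 1; ext x; simp [and_comm]
  have hRS : ∀ b, ∑ c, R b c = S b := fun b => by
    simp only [hS]
    rw [← sum_measureReal_inter_fiber hh]
    refine Finset.sum_congr rfl fun a _ => ?_
    simp only [hR]; congr 1; ext x; simp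
  have hS1 : ∑ b, S b = 1 := by
    have := sum_measureReal_inter_fiber (μ := μ) hg Set.univ
    simpa using this
  -- The weight `P` cancels, cells with `P = 0` only lose non-negative terms, and summing out `a`
  -- and `c` leaves `∑ S * S / S = 1`. Integrating `log t ≤ t - 1` at this ratio then gives the
  -- inequality.
  have key : ∫ x, Q (f x) (g x) * R (g x) (h x) / (P (f x) (g x) (h x) * S (g x)) ∂μ ≤ 1 := by
    rw [integral_comp_of_fintype (μ := μ) hfgh
      fun t => Q t.1 t.2.1 * R t.2.1 t.2.2 / (P t.1 t.2.1 t.2.2 * S t.2.1)]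
    calc _ ≤ ∑ t : α × β × γ, Q t.1 t.2.1 * R t.2.1 t.2.2 / S t.2.1 := by
          refine Finset.sum_le_sum fun t _ => ?_
          change P t.1 t.2.1 t.2.2 * _ ≤ _
          have h0 : 0 ≤ Q t.1 t.2.1 * R t.2.1 t.2.2 / S t.2.1 := by positivity
          rcases eq_or_ne (P t.1 t.2.1 t.2.2) 0 with hp | hp
          · rw [hp, zero_mul]; exact h0
          · refine le_of_eq ?_
            field_simp
      _ = ∑ b, S b * S b / S b := by
          rw [Fintype.sum_prod_type]
          simp_rw [Fintype.sum_prod_type]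
          rw [Finset.sum_comm]
          refine Finset.sum_congr rfl fun b _ => ?_
          simp_rw [← Finset.sum_div, ← Finset.mul_sum, hRS, ← Finset.sum_mul, hQS]
      _ = 1 := by
          rw [← hS1]
          exact Finset.sum_congr rfl fun b _ => mul_self_div_self _
  have hi : ∀ φ : α × β × γ → ℝ, Integrable (fun x => φ (f x, g x, h x)) μ :=
    fun φ => integrable_comp_of_fintype hfgh φ
  have iP : Integrable (fun x => -Real.log (P (f x) (g x) (h x))) μ :=
    hi fun t => -Real.log (P t.1 t.2.1 t.2.2)
  have iQ : Integrable (fun x => -Real.log (Q (f x) (g x))) μ := hi fun t => -Real.log (Q t.1 t.2.1)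
  have iR : Integrable (fun x => -Real.log (R (g x) (h x))) μ :=
    hi fun t => -Real.log (R t.2.1 t.2.2)
  have iS : Integrable (fun x => -Real.log (S (g x))) μ := hi fun t => -Real.log (S t.2.1)
  have iF : Integrable
      (fun x => Q (f x) (g x) * R (g x) (h x) / (P (f x) (g x) (h x) * S (g x))) μ :=
    hi fun t => Q t.1 t.2.1 * R t.2.1 t.2.2 / (P t.1 t.2.1 t.2.2 * S t.2.1)
  have main : ∫ x, (-Real.log (P (f x) (g x) (h x)) + -Real.log (S (g x))) ∂μ ≤
      ∫ x, ((-Real.log (Q (f x) (g x)) + -Real.log (R (g x) (h x))) +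
        (Q (f x) (g x) * R (g x) (h x) / (P (f x) (g x) (h x) * S (g x)) - 1)) ∂μ := by
    refine integral_mono_ae (iP.add iS) ((iQ.add iR).add (iF.sub (integrable_const 1))) ?_
    filter_upwards [ae_measureReal_fiber_pos (μ := μ) (fun x => (f x, g x, h x)), ae_measureReal_fiber_pos (μ := μ) (fun x => (f x, g x)),
      ae_measureReal_fiber_pos (μ := μ) (fun x => (g x, h x)), ae_measureReal_fiber_pos (μ := μ) g] with x h1 h2 h3 h4
    change 0 < P (f x) (g x) (h x) at h1
    change 0 < Q (f x) (g x) at h2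
    change 0 < R (g x) (h x) at h3
    change 0 < S (g x) at h4
    have h5 := Real.log_le_sub_one_of_pos (div_pos (mul_pos h2 h3) (mul_pos h1 h4))
    rw [Real.log_div (mul_pos h2 h3).ne' (mul_pos h1 h4).ne', Real.log_mul h2.ne' h3.ne',
      Real.log_mul h1.ne' h4.ne'] at h5
    linarith
  have e1 : ∫ x, ((-Real.log (Q (f x) (g x)) + -Real.log (R (g x) (h x))) +
        (Q (f x) (g x) * R (g x) (h x) / (P (f x) (g x) (h x) * S (g x)) - 1)) ∂μ =
      ∫ x, (-Real.log (Q (f x) (g x)) + -Real.log (R (g x) (h x))) ∂μ +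
      ∫ x, (Q (f x) (g x) * R (g x) (h x) / (P (f x) (g x) (h x) * S (g x)) - 1) ∂μ :=
    integral_add (iQ.add iR) (iF.sub (integrable_const 1))
  rw [integral_add iP iS, e1, integral_add iQ iR, integral_sub iF (integrable_const 1)] at main
  rw [partitionEntropy_eq_integral hfgh, partitionEntropy_eq_integral hg,
    partitionEntropy_eq_integral hfg, partitionEntropy_eq_integral hgh]
  simp only [integral_const, probReal_univ, smul_eq_mul, mul_one] at main
  linarith

/-- The conditional probability of `s` given a finite partition. -/
lemma condExp_comap_fintype {f : Ω → α} (hf : Measurable f) {s : Set Ω} (hs : MeasurableSet s) :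
    μ[s.indicator (fun _ => (1 : ℝ)) | MeasurableSpace.comap f inferInstance] =ᵐ[μ]
      fun x => μ.real (s ∩ f ⁻¹' {f x}) / μ.real (f ⁻¹' {f x}) := by
  symm
  set φ : α → ℝ := fun i => μ.real (s ∩ f ⁻¹' {i}) / μ.real (f ⁻¹' {i}) with hφ
  refine ae_eq_condExp_of_forall_setIntegral_eq hf.comap_le
    ((integrable_const (1 : ℝ)).indicator hs)
    (fun t _ _ => (integrable_comp_of_fintype hf φ).integrableOn) ?_ ?_
  · rintro _ ⟨t, ht, rfl⟩ _
    rw [← integral_indicator (hf ht), integral_indicator hs, setIntegral_const, smul_eq_mul, mul_one,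
      measureReal_restrict_apply hs, ← sum_measureReal_inter_fiber hf (s ∩ f ⁻¹' t)]
    have : (f ⁻¹' t).indicator (fun x => φ (f x)) = fun x => t.indicator φ (f x) := by
      ext x; by_cases h : f x ∈ t <;> simp [Set.indicator, h]
    rw [this, integral_comp_of_fintype hf]
    refine Finset.sum_congr rfl fun i _ => ?_
    by_cases hi : i ∈ t
    · rw [Set.indicator_of_mem hi]
      have h1 : s ∩ f ⁻¹' t ∩ f ⁻¹' {i} = s ∩ f ⁻¹' {i} := by
        ext x; simp only [Set.mem_inter_iff, Set.mem_preimage, Set.mem_singleton_iff]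
        constructor
        · rintro ⟨⟨h, _⟩, h'⟩; exact ⟨h, h'⟩
        · rintro ⟨h, rfl⟩; exact ⟨⟨h, hi⟩, rfl⟩
      rw [h1]
      -- On a null cell the quotient is `0` by convention, and so is the mass it should reproduce.
      rcases eq_or_ne (μ.real (f ⁻¹' {i})) 0 with h0 | h0
      · rw [h0, zero_mul]
        exact (le_antisymm (h0 ▸ measureReal_mono Set.inter_subset_right) measureReal_nonneg).symm
      · exact mul_div_cancel₀ _ h0
    · have h1 : s ∩ f ⁻¹' t ∩ f ⁻¹' {i} = ∅ := by
        ext x; simp only [Set.mem_inter_iff, Set.mem_preimage, Set.mem_singleton_iff,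
          Set.mem_empty_iff_false, iff_false, not_and]
        rintro ⟨_, h⟩ rfl; exact hi h
      rw [h1, Set.indicator_of_notMem hi, mul_zero, measureReal_empty]
  · exact ((measurable_of_finite φ).comp
      (comap_measurable f)).stronglyMeasurable.aestronglyMeasurable

/-- The conditional Shannon entropy as the mean entropy of the conditional probabilities. -/
lemma partitionEntropy_prod_sub {g : Ω → β} {f : Ω → α} (hg : Measurable g) (hf : Measurable f) :
    partitionEntropy μ (fun x => (g x, f x)) - partitionEntropy μ f =
      ∫ x, ∑ j, Real.negMulLog ((μ[(g ⁻¹' {j}).indicator (fun _ => (1 : ℝ)) |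
        MeasurableSpace.comap f inferInstance]) x) ∂μ := by
  have hmod : (fun x => ∑ j, Real.negMulLog ((μ[(g ⁻¹' {j}).indicator (fun _ => (1 : ℝ)) |
        MeasurableSpace.comap f inferInstance]) x)) =ᵐ[μ]
      fun x => (fun i => ∑ j, Real.negMulLog
        (μ.real (g ⁻¹' {j} ∩ f ⁻¹' {i}) / μ.real (f ⁻¹' {i}))) (f x) := by
    filter_upwards [ae_all_iff.2 fun j =>
      condExp_comap_fintype (μ := μ) hf (hg (measurableSet_singleton j))] with x hx
    exact Finset.sum_congr rfl fun j _ => by rw [hx j]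
  rw [integral_congr_ae hmod, integral_comp_of_fintype hf fun i => ∑ j, Real.negMulLog
        (μ.real (g ⁻¹' {j} ∩ f ⁻¹' {i}) / μ.real (f ⁻¹' {i}))]
  have h1 : partitionEntropy μ (fun x => (g x, f x)) =
      ∑ i, ∑ j, Real.negMulLog (μ.real (g ⁻¹' {j} ∩ f ⁻¹' {i})) := by
    rw [partitionEntropy, Fintype.sum_prod_type, Finset.sum_comm]
    refine Finset.sum_congr rfl fun i _ => Finset.sum_congr rfl fun j _ => ?_
    congr 2; ext x; simp
  rw [h1, partitionEntropy, ← Finset.sum_sub_distrib]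
  refine Finset.sum_congr rfl fun i _ => ?_
  have h2 : ∑ j, μ.real (g ⁻¹' {j} ∩ f ⁻¹' {i}) = μ.real (f ⁻¹' {i}) := by
    rw [← sum_measureReal_inter_fiber hg (f ⁻¹' {i})]
    exact Finset.sum_congr rfl fun j _ => by rw [Set.inter_comm]
  set p := μ.real (f ⁻¹' {i}) with hp
  have h3 : Real.negMulLog p = ∑ j, -μ.real (g ⁻¹' {j} ∩ f ⁻¹' {i}) * Real.log p := by
    rw [← Finset.sum_mul, Finset.sum_neg_distrib, h2, Real.negMulLog]
  rw [h3, ← Finset.sum_sub_distrib, Finset.mul_sum]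
  refine Finset.sum_congr rfl fun j _ => ?_
  have hle : μ.real (g ⁻¹' {j} ∩ f ⁻¹' {i}) ≤ p := measureReal_mono Set.inter_subset_right
  have h0 : 0 ≤ μ.real (g ⁻¹' {j} ∩ f ⁻¹' {i}) := measureReal_nonneg
  set q := μ.real (g ⁻¹' {j} ∩ f ⁻¹' {i})
  rcases h0.eq_or_lt with hq | hq
  · simp [← hq]
  · have hp0 : 0 < p := hq.trans_le hle
    rw [Real.negMulLog, Real.negMulLog, Real.log_div hq.ne' hp0.ne']
    field_simp
    ring

lemma condExp_indicator_mem_Icc (m : MeasurableSpace Ω) (hm : m ≤ mΩ) {s : Set Ω}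
    (hs : MeasurableSet[mΩ] s) :
    ∀ᵐ x ∂μ, (μ[s.indicator (fun _ => (1 : ℝ)) | m]) x ∈ Set.Icc (0 : ℝ) 1 := by
  have h0 : 0 ≤ᵐ[μ] μ[s.indicator (fun _ => (1 : ℝ)) | m] :=
    condExp_nonneg (Eventually.of_forall fun x => Set.indicator_nonneg (fun _ _ => zero_le_one) x)
  have h1 : μ[s.indicator (fun _ => (1 : ℝ)) | m] ≤ᵐ[μ] μ[fun _ => (1 : ℝ) | m] :=
    condExp_mono ((integrable_const 1).indicator hs) (integrable_const 1)
      (Eventually.of_forall fun x => Set.indicator_le_self' (fun _ _ => zero_le_one) x)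
  rw [condExp_const hm] at h1
  filter_upwards [h0, h1] with x h0 h1 using ⟨h0, h1⟩

/-- Conditional entropies converge along an increasing sequence of finite partitions. -/
lemma tendsto_partitionEntropy_prod_sub {ι : ℕ → Type*} [∀ n, Fintype (ι n)]
    [∀ n, MeasurableSpace (ι n)] [∀ n, MeasurableSingletonClass (ι n)]
    {f : ∀ n, Ω → ι n} (hf : ∀ n, Measurable (f n)) {g : Ω → β} (hg : Measurable g)
    (hmono : Monotone fun n => MeasurableSpace.comap (f n) inferInstance) :
    Tendsto (fun n => partitionEntropy μ (fun x => (g x, f n x)) - partitionEntropy μ (f n)) atTop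
      (𝓝 (∫ x, ∑ j, Real.negMulLog ((μ[(g ⁻¹' {j}).indicator (fun _ => (1 : ℝ)) |
        ⨆ n, MeasurableSpace.comap (f n) inferInstance]) x) ∂μ)) := by
  let ℱ : Filtration ℕ mΩ :=
    ⟨fun n => MeasurableSpace.comap (f n) inferInstance, hmono, fun n => (hf n).comap_le⟩
  simp_rw [partitionEntropy_prod_sub hg (hf _)]
  refine tendsto_integral_of_dominated_convergence (fun _ => ∑ _j : β, 1) ?_
    (integrable_const _) ?_ ?_
  · intro n
    refine Finset.aestronglyMeasurable_fun_sum _ fun j _ => ?_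
    exact Real.continuous_negMulLog.comp_aestronglyMeasurable
      integrable_condExp.aestronglyMeasurable
  · intro n
    filter_upwards [ae_all_iff.2 fun j => condExp_indicator_mem_Icc (μ := μ) _ (ℱ.le n)
      (hg (measurableSet_singleton j))] with x hx
    refine (norm_sum_le _ _).trans (Finset.sum_le_sum fun j _ => ?_)
    obtain ⟨h0, h1⟩ := hx j
    rw [Real.norm_eq_abs, abs_of_nonneg (Real.negMulLog_nonneg h0 h1)]
    exact (Real.negMulLog_le_one_sub_self h0).trans (by linarith [show (0 : ℝ) ≤ _ from h0])
  · filter_upwards [ae_all_iff.2 fun j => tendsto_ae_condExp (μ := μ) (ℱ := ℱ)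
      ((g ⁻¹' {j}).indicator (fun _ => (1 : ℝ)))] with x hx
    exact tendsto_finsetSum _ fun j _ =>
      (Real.continuous_negMulLog.tendsto _).comp (hx j)

lemma measurable_itinerary {T : Ω → Ω} (hT : Measurable T) {f : Ω → α} (hf : Measurable f) (n : ℕ) :
    Measurable (itinerary T f n) :=
  measurable_pi_lambda _ fun t => hf.comp (hT.iterate t)

lemma itinerary_eq_iff {Ω α : Type*} {T : Ω → Ω} {f : Ω → α} {n : ℕ} {x y : Ω} :
    itinerary T f n x = itinerary T f n y ↔ ∀ t < n, f (T^[t] x) = f (T^[t] y) := by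
  simp [funext_iff, itinerary, Fin.forall_iff]

/-- `h(T, f)` exceeds `h(T, p)` by at most the conditional entropy of `f` given `p`. -/
lemma partitionEntropy_itinerary_le {T : Ω → Ω} (hT : MeasurePreserving T μ μ) {f : Ω → α}
    {p : Ω → β} (hf : Measurable f) (hp : Measurable p) (n : ℕ) :
    partitionEntropy μ (itinerary T f n) ≤ partitionEntropy μ (itinerary T p n) +
      n * (partitionEntropy μ (fun x => (f x, p x)) - partitionEntropy μ p) := by
  have hF := fun n => measurable_itinerary hT.measurable hf n
  have hP := fun n => measurable_itinerary hT.measurable hp n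
  -- The induction runs on the joint entropy. With `X`, `Y` the two itineraries, adding `(f', p')`
  -- to `(X, Y)` costs at most what adding it to `Y` costs (`s1`), and given `p'` dropping `Y` only
  -- raises the cost of `f'` (`s2`).
  have key : partitionEntropy μ (fun x => (itinerary T f n x, itinerary T p n x)) ≤
      partitionEntropy μ (itinerary T p n) +
      n * (partitionEntropy μ (fun x => (f x, p x)) - partitionEntropy μ p) := by
    induction n with
    | zero =>
      rw [Nat.cast_zero, zero_mul, add_zero]
      exact partitionEntropy_mono (hP 0) ((hF 0).prodMk (hP 0))
        fun x y _ => Prod.ext (funext fun t => t.elim0) (funext fun t => t.elim0)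
    | succ n ih =>
      set X := itinerary T f n
      set Y := itinerary T p n
      set f' : Ω → α := fun x => f (T^[n] x)
      set p' : Ω → β := fun x => p (T^[n] x)
      have hf' : Measurable f' := hf.comp (hT.measurable.iterate n)
      have hp' : Measurable p' := hp.comp (hT.measurable.iterate n)
      have s1 := partitionEntropy_submodular (μ := μ) (hF n) (hP n) (hf'.prodMk hp')
      have s2 := partitionEntropy_submodular (μ := μ) (hP n) hp' hf'
      have e1 : partitionEntropy μ (fun x => (f' x, p' x)) =
          partitionEntropy μ (fun x => (f x, p x)) :=
        partitionEntropy_comp (hT.iterate n) (hf.prodMk hp)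
      have e2 : partitionEntropy μ p' = partitionEntropy μ p :=
        partitionEntropy_comp (hT.iterate n) hp
      have e3 : partitionEntropy μ (fun x => (p' x, f' x)) =
          partitionEntropy μ (fun x => (f' x, p' x)) :=
        partitionEntropy_congr (hp'.prodMk hf') (hf'.prodMk hp') fun x y => by
          simp [and_comm]
      have e4 : partitionEntropy μ (fun x => (itinerary T f (n + 1) x, itinerary T p (n + 1) x)) =
          partitionEntropy μ (fun x => (X x, Y x, f' x, p' x)) :=
        partitionEntropy_congr ((hF _).prodMk (hP _))
          ((hF n).prodMk ((hP n).prodMk (hf'.prodMk hp'))) fun x y => by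
          simp only [Prod.mk.injEq, X, Y, itinerary_eq_iff, f', p', Nat.forall_lt_succ_right]
          tauto
      have e5 : partitionEntropy μ (itinerary T p (n + 1)) =
          partitionEntropy μ (fun x => (Y x, p' x)) :=
        partitionEntropy_congr (hP _) ((hP n).prodMk hp') fun x y => by
          simp only [Prod.mk.injEq, Y, itinerary_eq_iff, p', Nat.forall_lt_succ_right]
      have e6 : partitionEntropy μ (fun x => (Y x, p' x, f' x)) =
          partitionEntropy μ (fun x => (Y x, f' x, p' x)) :=
        partitionEntropy_congr ((hP n).prodMk (hp'.prodMk hf'))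
          ((hP n).prodMk (hf'.prodMk hp')) fun x y => by
          simp only [Prod.mk.injEq]; tauto
      rw [e4, e5]
      push_cast
      linarith
  exact (partitionEntropy_mono ((hF n).prodMk (hP n)) (hF n) fun x y h =>
    (Prod.ext_iff.1 h).1).trans key

end Shannon

/-! ### Finite words and the σ-algebras they generate -/

section Words

variable {A : Type*}

/-- The word read off `x` on the window `[a, a + m)`. -/
def word (a : ℤ) (m : ℕ) (x : ℤ → A) : Fin m → A := fun i => x (a + (i : ℕ))

lemma word_eq_iff {a : ℤ} {m : ℕ} {x y : ℤ → A} :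
    word a m x = word a m y ↔ ∀ z, a ≤ z → z < a + m → x z = y z := by
  simp only [funext_iff, word, Fin.forall_iff]
  constructor
  · intro h z h1 h2
    have := h (z - a).toNat (by omega)
    rwa [show a + ((z - a).toNat : ℤ) = z by omega] at this
  · intro h i hi
    exact h _ (by omega) (by omega)

lemma measurable_word [MeasurableSpace A] (a : ℤ) (m : ℕ) :
    Measurable (word a m : (ℤ → A) → Fin m → A) :=
  measurable_pi_lambda _ fun _ => measurable_pi_apply _

lemma comap_word_mono [MeasurableSpace A] {a b : ℤ} {m n : ℕ} (h1 : b ≤ a)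
    (h2 : a + m ≤ b + n) :
    MeasurableSpace.comap (word a m : (ℤ → A) → _) inferInstance ≤
      MeasurableSpace.comap (word b n) inferInstance := by
  refine Measurable.comap_le (m₁ := MeasurableSpace.comap (word b n) inferInstance)
    (@measurable_pi_lambda _ _ _ (MeasurableSpace.comap (word b n) inferInstance) _ _ fun i => ?_)
  have h : (fun x : ℤ → A => word a m x i) =
      (fun v : Fin n → A => v ⟨(a + (i : ℕ) - b).toNat, by omega⟩) ∘ word b n := by
    ext x
    simp only [word, Function.comp]
    congr 1; omega
  rw [h]
  exact (measurable_pi_apply _).comp (comap_measurable _)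

/-- The words on the windows `[-⌊n/2⌋, -⌊n/2⌋ + n)`, which exhaust `ℤ`. -/
def centredWord (n : ℕ) : (ℤ → A) → Fin n → A := word (-((n / 2 : ℕ) : ℤ)) n

lemma measurable_centredWord [MeasurableSpace A] (n : ℕ) :
    Measurable (centredWord n : (ℤ → A) → Fin n → A) :=
  measurable_word _ _

lemma monotone_comap_centredWord [MeasurableSpace A] :
    Monotone fun n => MeasurableSpace.comap (centredWord n : (ℤ → A) → _) inferInstance :=
  fun _ _ h => comap_word_mono (by omega) (by omega)

lemma iSup_comap_centredWord [MeasurableSpace A] :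
    ⨆ n, MeasurableSpace.comap (centredWord n : (ℤ → A) → _) inferInstance =
      (inferInstance : MeasurableSpace (ℤ → A)) := by
  refine le_antisymm (iSup_le fun n => (measurable_word _ _).comap_le) ?_
  refine iSup_le fun z => ?_
  -- For this length the window is `[-|z| - 1, |z| + 1)`, which contains `z`.
  refine le_trans ?_ (le_iSup _ (2 * z.natAbs + 2))
  refine Measurable.comap_le (m₁ := MeasurableSpace.comap (centredWord _) inferInstance) ?_
  have h : (fun x : ℤ → A => x z) =
      (fun v : Fin (2 * z.natAbs + 2) → A => v ⟨(z + z.natAbs + 1).toNat, by omega⟩) ∘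
        centredWord _ := by
    ext x
    simp only [centredWord, word, Function.comp]
    congr 1; omega
  rw [h]
  exact (measurable_pi_apply _).comp (comap_measurable _)

end Words

/-! ### Reconstructing points from images under a bipermutative rule -/

section Permutive

variable {A : Type*} {ℓ r : ℕ} {φ : (Fin (ℓ + r + 1) → A) → A}

lemma RightPermutative.eq_of_window (hφ : RightPermutative φ) {x y : ℤ → A} {z : ℤ}
    (h : ∀ t, z - ℓ ≤ t → t < z + r → x t = y t)
    (hz : ofLocalRule ℓ r φ x z = ofLocalRule ℓ r φ y z) : x (z + r) = y (z + r) := by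
  have key : ∀ u : ℤ → A, (fun i : Fin (ℓ + r + 1) => u (z - (ℓ : ℤ) + ((i : ℕ) : ℤ))) =
      Fin.snoc (α := fun _ => A) (fun i : Fin (ℓ + r) => u (z - ℓ + (i : ℕ))) (u (z + r)) := by
    intro u
    ext i
    refine Fin.lastCases ?_ (fun i => ?_) i
    · rw [Fin.snoc_last]; congr 1; simp; omega
    · rw [Fin.snoc_castSucc]; rfl
  have hxy : (fun i : Fin (ℓ + r) => x (z - ℓ + (i : ℕ))) =
      fun i : Fin (ℓ + r) => y (z - ℓ + (i : ℕ)) := by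
    ext i; exact h _ (by omega) (by omega)
  unfold ofLocalRule at hz
  rw [key x, key y, hxy] at hz
  exact (hφ _).1 hz

lemma LeftPermutative.eq_of_window (hφ : LeftPermutative φ) {x y : ℤ → A} {z : ℤ}
    (h : ∀ t, z - ℓ < t → t ≤ z + r → x t = y t)
    (hz : ofLocalRule ℓ r φ x z = ofLocalRule ℓ r φ y z) : x (z - ℓ) = y (z - ℓ) := by
  have key : ∀ u : ℤ → A, (fun i : Fin (ℓ + r + 1) => u (z - (ℓ : ℤ) + ((i : ℕ) : ℤ))) =
      Fin.cons (α := fun _ => A) (u (z - ℓ))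
        (fun i : Fin (ℓ + r) => u (z - ℓ + ((i : ℕ) + 1 : ℕ))) := by
    intro u
    ext i
    refine Fin.cases ?_ (fun i => ?_) i
    · rw [Fin.cons_zero]; congr 1; simp
    · rw [Fin.cons_succ]; rfl
  have hxy : (fun i : Fin (ℓ + r) => x (z - ℓ + ((i : ℕ) + 1 : ℕ))) =
      fun i : Fin (ℓ + r) => y (z - ℓ + ((i : ℕ) + 1 : ℕ)) := by
    ext i; exact h _ (by omega) (by omega)
  unfold ofLocalRule at hz
  rw [key x, key y, hxy] at hz
  exact (hφ _).1 hz

/-- Agreement on `[-ℓ, r)` and agreement of the images on `[a, b)` force agreement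
on `[a - ℓ, b + r)`. -/
lemma eq_of_image_eq (hL : LeftPermutative φ) (hR : RightPermutative φ) {x y : ℤ → A} {a b : ℤ}
    (ha : a ≤ 0) (hb : 0 ≤ b) (h0 : ∀ z, -(ℓ : ℤ) ≤ z → z < r → x z = y z)
    (h : ∀ z, a ≤ z → z < b → ofLocalRule ℓ r φ x z = ofLocalRule ℓ r φ y z) :
    ∀ z, a - ℓ ≤ z → z < b + r → x z = y z := by
  -- The rule at site `d` reads `[d - ℓ, d + r]`, where only the last letter is still unknown, so
  -- agreement spreads rightwards one cell at a time. `left` is the mirror image, through the sites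
  -- `-d - 1`.
  have right : ∀ d : ℕ, (d : ℤ) ≤ b → ∀ z, -(ℓ : ℤ) ≤ z → z < r + d → x z = y z := by
    intro d
    induction d with
    | zero => intro _ z h1 h2; exact h0 z h1 (by omega)
    | succ d ih =>
      intro hd z h1 h2
      rcases lt_or_ge z (r + d) with hz | hz
      · exact ih (by omega) z h1 hz
      · have := hR.eq_of_window (x := x) (y := y) (z := d)
          (fun t h1 h2 => ih (by omega) t (by omega) (by omega)) (h _ (by omega) (by omega))
        rwa [show (d : ℤ) + r = z by omega] at this
  have left : ∀ d : ℕ, a ≤ -(d : ℤ) → ∀ z, -(ℓ : ℤ) - d ≤ z → z < b + r → x z = y z := by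
    intro d
    induction d with
    | zero =>
      intro _ z h1 h2
      exact right b.toNat (by omega) z (by omega) (by omega)
    | succ d ih =>
      intro hd z h1 h2
      rcases lt_or_ge z (-(ℓ : ℤ) - d) with hz | hz
      · rcases lt_or_ge (-(d : ℤ) - 1) b with hb' | hb'
        · have := hL.eq_of_window (x := x) (y := y) (z := -(d : ℤ) - 1)
            (fun t h1 h2 => ih (by omega) t (by omega) (by omega)) (h _ (by omega) (by omega))
          rwa [show -(d : ℤ) - 1 - ℓ = z by omega] at this
        · omega
      · exact ih (by omega) z hz h2
  intro z h1 h2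
  exact left (-a).toNat (by omega) z (by omega) h2

/-- The value of the image on `[a, b)` only depends on `[a - ℓ, b + r)`. -/
lemma image_eq_of_eq {x y : ℤ → A} {a b : ℤ} (h : ∀ z, a - ℓ ≤ z → z < b + r → x z = y z) :
    ∀ z, a ≤ z → z < b → ofLocalRule ℓ r φ x z = ofLocalRule ℓ r φ y z := by
  intro z h1 h2
  unfold ofLocalRule
  congr 1; ext i
  exact h _ (by omega) (by omega)

/-- A point is determined by its image and its word on `[-ℓ, r)`. -/
lemma eq_of_image_eq_of_word_eq (hL : LeftPermutative φ) (hR : RightPermutative φ) {x y : ℤ → A}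
    (h : ofLocalRule ℓ r φ x = ofLocalRule ℓ r φ y)
    (hw : word (-(ℓ : ℤ)) (ℓ + r) x = word (-(ℓ : ℤ)) (ℓ + r) y) : x = y := by
  rw [word_eq_iff] at hw
  ext z
  exact eq_of_image_eq hL hR (a := -|z|) (b := |z| + 1) (by simp) (by positivity)
    (fun z h1 h2 => hw z h1 (by push_cast; omega)) (fun z _ _ => congrFun h z) z
    (by have := neg_abs_le z; omega) (by have := le_abs_self z; omega)

/-- Each application of the rule consumes `ℓ` cells on the left and `r` on the right. -/
lemma iterate_eq_of_eq {x y : ℤ → A} (n : ℕ) {a b : ℤ}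
    (h : ∀ z, a - n * ℓ ≤ z → z < b + n * r → x z = y z) :
    ∀ z, a ≤ z → z < b → (ofLocalRule ℓ r φ)^[n] x z = (ofLocalRule ℓ r φ)^[n] y z := by
  induction n generalizing a b with
  | zero => intro z h1 h2; exact h z (by simpa using h1) (by simpa using h2)
  | succ n ih =>
    intro z h1 h2
    rw [Function.iterate_succ_apply', Function.iterate_succ_apply']
    refine image_eq_of_eq (a := a) (b := b) (fun z h1 h2 => ?_) z h1 h2
    refine ih (a := a - ℓ) (b := b + r) (fun z h1 h2 => h z ?_ ?_) z h1 h2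
    · push_cast; linarith
    · push_cast; linarith

/-- The itinerary of the word on `[-ℓ, r)` up to time `n` determines the word
on `[-nℓ, nr)`. -/
lemma eq_of_iterate_eq (hL : LeftPermutative φ) (hR : RightPermutative φ) (n : ℕ) {x y : ℤ → A}
    (h : ∀ t < n, ∀ z, -(ℓ : ℤ) ≤ z → z < r →
      (ofLocalRule ℓ r φ)^[t] x z = (ofLocalRule ℓ r φ)^[t] y z) :
    ∀ z, -(n * ℓ : ℤ) ≤ z → z < n * r → x z = y z := by
  induction n generalizing x y with
  | zero => intro z h1 h2; simp at h1 h2; omega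
  | succ n ih =>
    intro z h1 h2
    refine eq_of_image_eq hL hR (a := -(n * ℓ : ℤ)) (b := n * r) ?_ ?_
      (h 0 n.succ_pos) (ih fun t ht => ?_) z ?_ ?_
    · have : (0 : ℤ) ≤ n * ℓ := by positivity
      linarith
    · positivity
    · intro z h1 h2
      have := h (t + 1) (by omega) z h1 h2
      rwa [Function.iterate_succ_apply, Function.iterate_succ_apply] at this
    · push_cast at h1; linarith
    · push_cast at h2; linarith

end Permutive

/-! ### The shift and word entropies -/

section Shift

variable {A : Type*}

lemma shift_injective : Function.Injective (shift : (ℤ → A) → ℤ → A) := by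
  intro x y h
  ext z
  have := congrFun h (z + 1)
  simpa [shift] using this

lemma shift_ofLocalRule (ℓ r : ℕ) (φ : (Fin (ℓ + r + 1) → A) → A) (x : ℤ → A) :
    shift (ofLocalRule ℓ r φ x) = ofLocalRule ℓ r φ (shift x) := by
  ext z
  simp only [shift, ofLocalRule]
  congr 1; ext i; congr 1; ring

lemma word_shift (a : ℤ) (m : ℕ) (x : ℤ → A) : word a m (shift x) = word (a - 1) m x := by
  ext i
  simp only [word, shift]
  congr 1; ring

/-- For a shift-invariant measure, the entropy of a word only depends on its length. -/
lemma partitionEntropy_word [Fintype A] [MeasurableSpace A] [MeasurableSingletonClass A]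
    {μ : Measure (ℤ → A)} [IsProbabilityMeasure μ] (hμ : MeasurePreserving shift μ μ)
    (a : ℤ) (m : ℕ) :
    partitionEntropy μ (word a m) = partitionEntropy μ (word 0 m) := by
  have step : ∀ a : ℤ, partitionEntropy μ (word (a - 1) m) = partitionEntropy μ (word a m) := by
    intro a
    rw [← partitionEntropy_comp hμ (measurable_word a m)]
    simp_rw [word_shift]
  induction a with
  | zero => rfl
  | succ n ih =>
    rw [← ih, ← step (n + 1), add_sub_cancel_right]
  | pred n ih => rw [step, ih]

end Shift

/-- Two ergodic probability measures are equal or mutually singular. -/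
lemma eq_or_mutuallySingular_of_ergodic {X : Type*} [MeasurableSpace X] {T : X → X}
    {μ ν : Measure X} [IsProbabilityMeasure μ] [IsProbabilityMeasure ν] (hμ : Ergodic T μ)
    (hν : Ergodic T ν) : ν = μ ∨ ν ⟂ₘ μ := by
  -- The singular part is invariant and dominated by `ν`, hence a multiple `c • ν` by ergodicity. If
  -- `c = 0` then `ν ≪ μ`, and ergodicity of `μ` gives equality; otherwise `ν` is itself singular.
  have hs : MeasurePreserving T (ν.singularPart μ) (ν.singularPart μ) :=
    hν.toMeasurePreserving.singularPart hμ.toMeasurePreserving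
  obtain ⟨c, hc⟩ := hν.eq_smul_of_absolutelyContinuous hs
    (Measure.singularPart_le ν μ).absolutelyContinuous
  rcases eq_or_ne c 0 with rfl | hc0
  · left
    rw [zero_smul, Measure.singularPart_eq_zero] at hc
    exact hμ.eq_of_absolutelyContinuous hν.toMeasurePreserving hc
  · right
    have := Measure.mutuallySingular_singularPart ν μ
    rw [hc] at this
    exact this.mono_ac (Measure.absolutelyContinuous_smul hc0) .rfl

/-- Families of probability measures that agree almost everywhere on each measurable set are
almost everywhere equal. -/
lemma ae_eq_of_forall_measurableSet {X Y : Type*} [MeasurableSpace X] {mY : MeasurableSpace Y}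
    [MeasurableSpace.CountablyGenerated Y] {μ : Measure X} {κ ν : X → Measure Y}
    [∀ x, IsProbabilityMeasure (κ x)] [∀ x, IsProbabilityMeasure (ν x)]
    (h : ∀ s, MeasurableSet s → ∀ᵐ x ∂μ, κ x s = ν x s) : ∀ᵐ x ∂μ, κ x = ν x := by
  -- The σ-algebras of these refining finite partitions are finite and nested. Their union is a
  -- countable generating π-system, so the exceptional null sets can be merged.
  let m : ℕ → MeasurableSpace Y := fun n =>
    MeasurableSpace.generateFrom (MeasurableSpace.countablePartition Y n)
  let C : Set (Set Y) := ⋃ n, {s | MeasurableSet[m n] s}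
  have hm : ∀ n, m n ≤ mY := fun n => MeasurableSpace.generateFrom_countablePartition_le Y n
  have hmono : Monotone m := monotone_nat_of_le_succ fun n =>
    MeasurableSpace.generateFrom_countablePartition_le_succ Y n
  have hC : C.Countable := by
    refine Set.countable_iUnion fun n => ?_
    have hfin := MeasurableSpace.finite_countablePartition Y n
    refine Set.Finite.countable ((hfin.finite_subsets.image Set.sUnion).subset ?_)
    intro s hs
    obtain ⟨S, hS, rfl⟩ := (MeasurableSpace.measurableSet_generateFrom_countablePartition_iff n s).1 hs
    exact ⟨S, hS, rfl⟩
  have hpi : IsPiSystem C := by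
    refine isPiSystem_iUnion_of_monotone _ (fun n => @MeasurableSpace.isPiSystem_measurableSet Y (m n)) ?_
    intro i j hij s hs
    exact hmono hij s hs
  have hgen : mY = MeasurableSpace.generateFrom C := by
    rw [show MeasurableSpace.generateFrom C = ⨆ n, m n from
      MeasurableSpace.generateFrom_iUnion_measurableSet m]
    refine le_antisymm ?_ (iSup_le hm)
    rw [← MeasurableSpace.generateFrom_iUnion_countablePartition Y]
    refine MeasurableSpace.generateFrom_le fun s hs => ?_
    obtain ⟨n, hn⟩ := Set.mem_iUnion.1 hs
    exact le_iSup m n s (MeasurableSpace.measurableSet_generateFrom hn)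
  have hae : ∀ᵐ x ∂μ, ∀ s ∈ C, κ x s = ν x s := by
    refine (ae_ball_iff hC).2 fun s hs => h s ?_
    obtain ⟨n, hn⟩ := Set.mem_iUnion.1 hs
    exact hm n s hn
  filter_upwards [hae] with x hx
  exact ext_of_generate_finite C hgen hpi hx (by simp)

lemma eq_of_measurable_comap {X Y Z : Type*} [MeasurableSpace Y] [MeasurableSpace Z]
    [MeasurableSingletonClass Z] {f : X → Y} {g : X → Z}
    (hg : Measurable[MeasurableSpace.comap f inferInstance] g) {x y : X} (h : f x = f y) :
    g x = g y := by
  obtain ⟨t, -, ht⟩ := hg (measurableSet_singleton (g x))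
  have hx : x ∈ f ⁻¹' t := by rw [ht]; rfl
  have hy : y ∈ f ⁻¹' t := by rw [Set.mem_preimage, ← h]; exact hx
  rw [ht] at hy
  exact hy.symm

/-- The kernel is `Φ⁻¹(𝔅)`-measurable, so this holds at every point and not only almost everywhere.
It replaces `μ_y{y}` by `μ_x{y}` in the definition of `ℰ(x)`. -/
lemma fibreMeasure_congr {X : Type*} [MeasurableSpace X] [StandardBorelSpace X] {Φ : X → X}
    {μ : Measure X} [IsFiniteMeasure μ] {x y : X} (h : Φ x = Φ y) :
    fibreMeasure Φ μ x = fibreMeasure Φ μ y :=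
  Measure.ext fun _ hs => eq_of_measurable_comap (measurable_condExpKernel hs) h

/-! ### The stabilizer of the measure in the kernel, and conditioning on `Φ` -/

section Endomorphism

variable {G : Type*} [Group G] [MeasurableSpace G] [MeasurableMul G]
  {Φ : G →* G} {μ : Measure G}

variable (Φ μ) in
/-- The elements of the kernel of `Φ` whose right translation preserves `μ`. -/
def kerStabilizer : Subgroup G where
  carrier := {k | k ∈ Φ.ker ∧ μ.map (· * k) = μ}
  one_mem' := ⟨one_mem _, by simp⟩
  mul_mem' := by
    rintro a b ⟨ha, ha'⟩ ⟨hb, hb'⟩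
    refine ⟨mul_mem ha hb, ?_⟩
    have : (fun x : G => x * (a * b)) = (· * b) ∘ (· * a) := by ext x; simp [mul_assoc]
    rw [this, ← Measure.map_map (measurable_mul_const b) (measurable_mul_const a), ha', hb']
  inv_mem' := by
    rintro a ⟨ha, ha'⟩
    refine ⟨inv_mem ha, ?_⟩
    conv_lhs => rw [← ha']
    rw [Measure.map_map (measurable_mul_const _) (measurable_mul_const a)]
    have : ((· * a⁻¹) ∘ (· * a) : G → G) = id := by ext x; simp
    rw [this, Measure.map_id]

lemma kerStabilizer_le_ker : kerStabilizer Φ μ ≤ Φ.ker := fun _ h => h.1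

lemma measurePreserving_mul_of_mem_kerStabilizer {k : G} (hk : k ∈ kerStabilizer Φ μ) :
    MeasurePreserving (· * k) μ μ := ⟨measurable_mul_const k, hk.2⟩

/-- Translation by an `S`-fixed element commutes with `S`, so the translated measure is again
`S`-ergodic. -/
lemma map_mul_eq_or_mutuallySingular [IsProbabilityMeasure μ] {S : G → G} (hS : Ergodic S μ)
    (hmul : ∀ x y, S (x * y) = S x * S y) {k : G} (hk : S k = k) :
    μ.map (· * k) = μ ∨ μ.map (· * k) ⟂ₘ μ := by
  have hp : MeasurePreserving (· * k) μ (μ.map (· * k)) := ⟨measurable_mul_const k, rfl⟩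
  have : IsProbabilityMeasure (μ.map (· * k)) :=
    Measure.isProbabilityMeasure_map (measurable_mul_const k).aemeasurable
  refine eq_or_mutuallySingular_of_ergodic hS
    (hp.ergodic_of_ergodic_semiconj hS hS.measurable ?_)
  intro x
  simp [hmul, hk]

/-- A set that, in almost every fibre of `Φ`, singles out one coset of `kerStabilizer`. -/
lemma exists_measurableSet_mem_iff_mem_kerStabilizer [IsProbabilityMeasure μ]
    (hK : (Φ.ker : Set G).Finite) {S : G → G} (hS : Ergodic S μ)
    (hmul : ∀ x y, S (x * y) = S x * S y) (hfix : ∀ k ∈ Φ.ker, S k = k) :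
    ∃ U : Set G, MeasurableSet U ∧
      ∀ᵐ x ∂μ, ∀ k ∈ Φ.ker, x * k ∈ U ↔ k ∈ kerStabilizer Φ μ := by
  -- For `k` outside the stabilizer, `N k` is a `μ`-null set carrying the translate of `μ` by `k`.
  -- Removing these finitely many sets leaves `U`.
  have hN : ∀ k ∈ Φ.ker, ∃ N : Set G, MeasurableSet N ∧ μ N = 0 ∧
      (k ∉ kerStabilizer Φ μ → ∀ᵐ x ∂μ, x * k ∈ N) := by
    intro k hk
    by_cases hkJ : k ∈ kerStabilizer Φ μ
    · exact ⟨∅, MeasurableSet.empty, measure_empty, fun h => absurd hkJ h⟩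
    · have hsing : μ.map (· * k) ⟂ₘ μ :=
        (map_mul_eq_or_mutuallySingular hS hmul (hfix k hk)).resolve_left
          fun h => hkJ ⟨hk, h⟩
      obtain ⟨N, hN, h1, h2⟩ := hsing
      refine ⟨Nᶜ, hN.compl, h2, fun _ => ?_⟩
      rw [Measure.map_apply (measurable_mul_const k) hN] at h1
      exact measure_eq_zero_iff_ae_notMem.1 h1
  choose! N hNm hN0 hN1 using hN
  have hU0 : ∀ᵐ x ∂μ, x ∈ ⋂ k ∈ Φ.ker, (N k)ᶜ := by
    have : ∀ᵐ x ∂μ, ∀ k ∈ (Φ.ker : Set G), x ∉ N k :=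
      (ae_ball_iff hK.countable).2 fun k hk => measure_eq_zero_iff_ae_notMem.1 (hN0 k hk)
    filter_upwards [this] with x hx
    simpa using hx
  refine ⟨⋂ k ∈ Φ.ker, (N k)ᶜ,
    MeasurableSet.biInter hK.countable fun k hk => (hNm k hk).compl, ?_⟩
  refine (ae_ball_iff (S := (Φ.ker : Set G)) hK.countable).2 fun k hk => ?_
  by_cases hkJ : k ∈ kerStabilizer Φ μ
  · filter_upwards
      [(measurePreserving_mul_of_mem_kerStabilizer hkJ).quasiMeasurePreserving.ae hU0] with x hx
    exact iff_of_true hx hkJ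
  · filter_upwards [hN1 k hk hkJ] with x hx
    refine iff_of_false (fun h => ?_) hkJ
    exact Set.mem_iInter₂.1 h k hk hx

lemma exists_mul_eq_of_map_eq {G : Type*} [Group G] {Φ : G →* G} {x y : G} (h : Φ y = Φ x) : ∃ k ∈ Φ.ker, y = x * k :=
  ⟨x⁻¹ * y, by simp [MonoidHom.mem_ker, h], by simp⟩

lemma map_mul_of_mem_ker {G : Type*} [Group G] {Φ : G →* G} {x k : G} (h : k ∈ Φ.ker) : Φ (x * k) = Φ x := by
  rw [map_mul, MonoidHom.mem_ker.1 h, mul_one]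

/-- The saturation of `W` is a finite union of translates, hence measurable. In a standard Borel
space, measurability of the preimage descends to the image inside the range. -/
lemma measurableSet_image_of_finite_ker [StandardBorelSpace G] (hΦ : Measurable Φ)
    (hr : MeasurableSet (Set.range Φ)) (hK : (Φ.ker : Set G).Finite) {W : Set G}
    (hW : MeasurableSet W) : MeasurableSet (Φ '' W) := by
  have h : Φ ⁻¹' (Φ '' W) = ⋃ k ∈ Φ.ker, (· * k) ⁻¹' W := by
    ext x
    simp only [Set.mem_preimage, Set.mem_image, Set.mem_iUnion, exists_prop]
    constructor
    · rintro ⟨y, hy, hxy⟩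
      obtain ⟨k, hk, rfl⟩ := exists_mul_eq_of_map_eq hxy
      exact ⟨k, hk, hy⟩
    · rintro ⟨k, hk, hy⟩
      exact ⟨_, hy, map_mul_of_mem_ker hk⟩
  have h1 : MeasurableSet (Φ ⁻¹' (Φ '' W)) := by
    rw [h]
    exact MeasurableSet.biUnion hK.countable fun k _ => measurable_mul_const k hW
  have h2 := (hΦ.measurableSet_preimage_iff_inter_range hr).1 h1
  rwa [Set.inter_eq_left.2 (Set.image_subset_range _ _)] at h2

/-- A measurable function that is constant on the fibres of `Φ` is `Φ⁻¹`-measurable. -/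
lemma measurable_comap_of_mul_ker [StandardBorelSpace G] (hΦ : Measurable Φ)
    (hr : MeasurableSet (Set.range Φ)) (hK : (Φ.ker : Set G).Finite) {h : G → ℝ}
    (hm : Measurable h) (hinv : ∀ x, ∀ k ∈ Φ.ker, h (x * k) = h x) :
    Measurable[MeasurableSpace.comap Φ inferInstance] h := by
  intro s hs
  refine ⟨Φ '' (h ⁻¹' s), measurableSet_image_of_finite_ker hΦ hr hK (hm hs), ?_⟩
  refine Set.Subset.antisymm ?_ (Set.subset_preimage_image _ _)
  rintro x ⟨y, hy, hxy⟩
  obtain ⟨k, hk, rfl⟩ := exists_mul_eq_of_map_eq hxy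
  rwa [Set.mem_preimage, hinv x k hk] at hy

/-- The conditional probability given `Φ` is the average over a coset of `kerStabilizer`. -/
lemma condExp_comap_eq_average [StandardBorelSpace G] [IsProbabilityMeasure μ]
    (hΦ : Measurable Φ) (hr : MeasurableSet (Set.range Φ)) (hK : (Φ.ker : Set G).Finite)
    {S : G → G} (hS : Ergodic S μ) (hmul : ∀ x y, S (x * y) = S x * S y)
    (hfix : ∀ k ∈ Φ.ker, S k = k) [Fintype (kerStabilizer Φ μ)] {C : Set G}
    (hC : MeasurableSet C) :
    μ[C.indicator (fun _ => (1 : ℝ)) | MeasurableSpace.comap Φ inferInstance] =ᵐ[μ]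
      fun x => (∑ j : kerStabilizer Φ μ, C.indicator (fun _ => (1 : ℝ)) (x * j)) /
        Fintype.card (kerStabilizer Φ μ) := by
  set c : G → ℝ := C.indicator (fun _ => (1 : ℝ)) with hc
  have hcj : ∀ j : kerStabilizer Φ μ, Integrable (fun x => c (x * j)) μ := fun j =>
    (measurePreserving_mul_of_mem_kerStabilizer j.2).integrable_comp_of_integrable
      ((integrable_const (1 : ℝ)).indicator hC)
  have hint : Integrable (fun x => (∑ j : kerStabilizer Φ μ, c (x * j)) / Fintype.card (kerStabilizer Φ μ)) μ :=
    (integrable_finsetSum _ fun j _ => hcj j).div_const _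
  have hcard : (Fintype.card (kerStabilizer Φ μ) : ℝ) ≠ 0 := Nat.cast_ne_zero.2 Fintype.card_ne_zero
  symm
  refine ae_eq_condExp_of_forall_setIntegral_eq hΦ.comap_le
    ((integrable_const (1 : ℝ)).indicator hC) (fun _ _ _ => hint.integrableOn) ?_ ?_
  · rintro _ ⟨t, ht, rfl⟩ _
    have h1 : ∀ j : kerStabilizer Φ μ, ∫ x in Φ ⁻¹' t, c (x * j) ∂μ = ∫ x in Φ ⁻¹' t, c x ∂μ := by
      intro j
      have h3 := (measurePreserving_mul_of_mem_kerStabilizer j.2).integral_comp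
        (MeasurableEquiv.mulRight (j : G)).measurableEmbedding ((Φ ⁻¹' t).indicator c)
      rw [← integral_indicator (hΦ ht), ← integral_indicator (hΦ ht), ← h3]
      refine integral_congr_ae (Eventually.of_forall fun x => ?_)
      have h2 : Φ (x * j) = Φ x := map_mul_of_mem_ker j.2.1
      by_cases h : Φ x ∈ t <;> simp [Set.indicator, h, h2]
    rw [integral_div, integral_finsetSum _ fun j _ => (hcj j).integrableOn]
    simp_rw [h1]
    rw [Finset.sum_const, Finset.card_univ, nsmul_eq_mul, mul_div_cancel_left₀ _ hcard]
  -- The average over `x J` need not be constant on fibres. Summing the indicator of `U ∩ C` over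
  -- the whole kernel is, and it agrees almost everywhere because `U` selects exactly `x J`.
  · obtain ⟨U, hU, hUJ⟩ := exists_measurableSet_mem_iff_mem_kerStabilizer hK hS hmul hfix
    have : Fintype Φ.ker := hK.fintype
    let h : G → ℝ := fun x =>
      (∑ k : Φ.ker, (U ∩ C).indicator (fun _ => (1 : ℝ)) (x * k)) / Fintype.card (kerStabilizer Φ μ)
    have hm : Measurable h := by
      refine Measurable.div_const (Finset.measurable_fun_sum _ fun k _ => ?_) _
      exact (measurable_const.indicator (hU.inter hC)).comp (measurable_mul_const (k : G))
    have hinv : ∀ x, ∀ k ∈ Φ.ker, h (x * k) = h x := by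
      intro x k hk
      simp only [h]
      congr 1
      refine Fintype.sum_equiv (Equiv.mulLeft (⟨k, hk⟩ : Φ.ker)) _ _ fun k' => ?_
      simp [mul_assoc]
    refine ⟨h, (measurable_comap_of_mul_ker hΦ hr hK hm hinv).stronglyMeasurable, ?_⟩
    filter_upwards [hUJ] with x hx
    simp only [h]
    congr 1
    classical
    rw [← Finset.sum_filter_add_sum_filter_not Finset.univ (fun k : Φ.ker => (k : G) ∈ kerStabilizer Φ μ)
      fun k => (U ∩ C).indicator (fun _ => (1 : ℝ)) (x * k),
      Finset.sum_eq_zero (s := Finset.univ.filter fun k : Φ.ker => ¬ (k : G) ∈ kerStabilizer Φ μ), add_zero]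
    · refine Finset.sum_bij (fun j _ => ⟨(j : G), j.2.1⟩) ?_ ?_ ?_ ?_
      · intro j _; simp
      · intro a _ b _ hab
        exact Subtype.ext (congrArg (fun k : Φ.ker => (k : G)) hab)
      · intro k hk
        exact ⟨⟨k, (Finset.mem_filter.1 hk).2⟩, Finset.mem_univ _, rfl⟩
      · intro j _
        have : x * j ∈ U := (hx j j.2.1).2 j.2
        simp [hc, Set.indicator, this]
    · intro k hk
      have : x * k ∉ U := fun h => (Finset.mem_filter.1 hk).2 ((hx k k.2).1 h)
      simp [this]

lemma isAEToOne_card_kerStabilizer [StandardBorelSpace G]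
    [IsProbabilityMeasure μ] (hΦ : MeasurePreserving Φ μ μ)
    (hr : MeasurableSet (Set.range Φ)) (hK : (Φ.ker : Set G).Finite) {S : G → G}
    (hS : Ergodic S μ) (hmul : ∀ x y, S (x * y) = S x * S y) (hfix : ∀ k ∈ Φ.ker, S k = k) :
    IsAEToOne Φ μ (Nat.card (kerStabilizer Φ μ)) := by
  obtain ⟨U, hU, hUJ⟩ := exists_measurableSet_mem_iff_mem_kerStabilizer hK hS hmul hfix
  have hU1 : ∀ᵐ x ∂μ, x ∈ U := by
    filter_upwards [hUJ] with x hx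
    simpa using (hx 1 (one_mem _)).2 (one_mem _)
  have hΦU : ∀ᵐ x ∂μ, Φ x ∈ U := hΦ.quasiMeasurePreserving.ae hU1
  refine ⟨U, hU, prob_compl_eq_zero_iff hU |>.1 hU1, ?_, ?_⟩
  · filter_upwards [hU1, hΦU] with x h1 h2
    exact propext (iff_of_true h2 h1)
  -- The count is required at almost every image point `u`, so the good set `W` is pushed forward:
  -- `Φ '' W` is measurable and has full measure by invariance.
  · let W : Set G := {x | ∀ k ∈ Φ.ker, x * k ∈ U ↔ k ∈ kerStabilizer Φ μ}
    have hW : MeasurableSet W := by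
      have : W = ⋂ k ∈ Φ.ker, {x | x * k ∈ U ↔ k ∈ kerStabilizer Φ μ} := by ext; simp [W]
      rw [this]
      refine MeasurableSet.biInter hK.countable fun k _ => ?_
      exact ((measurable_mul_const k) hU).iff (MeasurableSet.const _)
    have hΦW : MeasurableSet (Φ '' W) := measurableSet_image_of_finite_ker hΦ.measurable hr hK hW
    have h1 : ∀ᵐ x ∂μ, Φ x ∈ Φ '' W := by
      filter_upwards [hUJ] with x hx using ⟨x, hx, rfl⟩
    have h2 : ∀ᵐ u ∂μ, u ∈ Φ '' W := by
      have := (ae_map_iff hΦ.measurable.aemeasurable hΦW).2 h1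
      rwa [hΦ.map_eq] at this
    filter_upwards [h2]
    rintro _ ⟨x, hx, rfl⟩ -
    have h3 : U ∩ Φ ⁻¹' {Φ x} = (fun j => x * j) '' (kerStabilizer Φ μ : Set G) := by
      ext y
      constructor
      · rintro ⟨hyU, hy⟩
        obtain ⟨k, hk, rfl⟩ := exists_mul_eq_of_map_eq hy
        exact ⟨k, (hx k hk).1 hyU, rfl⟩
      · rintro ⟨j, hj, rfl⟩
        exact ⟨(hx j hj.1).2 hj, map_mul_of_mem_ker hj.1⟩
    rw [h3, (mul_right_injective x).encard_image]
    exact (Set.Finite.cast_ncard_eq (hK.subset kerStabilizer_le_ker)).symm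

end Endomorphism

/-! ### Fibre measures as uniform measures on cosets -/

section Endomorphism

open scoped ENNReal

variable {G : Type*} [Group G] [MeasurableSpace G]

/-- The uniform measure on the coset `x J`. -/
noncomputable def cosetMeasure (J : Subgroup G) [Fintype J] (x : G) : Measure G :=
  (Fintype.card J : ℝ≥0∞)⁻¹ • ∑ j : J, Measure.dirac (x * j)

instance (J : Subgroup G) [Fintype J] (x : G) : IsProbabilityMeasure (cosetMeasure J x) := by
  refine ⟨?_⟩
  simp only [cosetMeasure, Measure.smul_apply, Measure.finsetSum_apply, measure_univ,
    Finset.sum_const, Finset.card_univ, smul_eq_mul, nsmul_eq_mul, mul_one]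
  exact ENNReal.inv_mul_cancel (by simp) (by simp)

lemma cosetMeasure_pos_iff [MeasurableSingletonClass G] {J : Subgroup G} [Fintype J] {x : G} {s : Set G} :
    0 < cosetMeasure J x s ↔ ∃ j ∈ J, x * j ∈ s := by
  simp only [cosetMeasure, Measure.smul_apply, Measure.finsetSum_apply, Measure.dirac_apply,
    smul_eq_mul, pos_iff_ne_zero, ne_eq, mul_eq_zero, ENNReal.inv_eq_zero, ENNReal.natCast_ne_top,
    false_or, Finset.sum_eq_zero_iff, Finset.mem_univ, true_implies, not_forall]
  simp [Set.indicator_apply_eq_zero]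

lemma cosetMeasure_real_apply [MeasurableSingletonClass G] {J : Subgroup G} [Fintype J] {x : G} {s : Set G} :
    (cosetMeasure J x).real s =
      (∑ j : J, s.indicator (fun _ => (1 : ℝ)) (x * j)) / Fintype.card J := by
  have h : ∀ j : J, s.indicator (1 : G → ℝ≥0∞) (x * j) =
      ENNReal.ofReal (s.indicator (fun _ => (1 : ℝ)) (x * j)) := fun j => by
    by_cases hj : x * j ∈ s <;> simp [hj]
  simp only [measureReal_def, cosetMeasure, Measure.smul_apply, Measure.finsetSum_apply,
    Measure.dirac_apply, smul_eq_mul, ENNReal.toReal_mul, ENNReal.toReal_inv,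
    ENNReal.toReal_natCast, h]
  rw [← ENNReal.ofReal_sum_of_nonneg fun j _ => Set.indicator_nonneg (fun _ _ => zero_le_one) _,
    ENNReal.toReal_ofReal
      (Finset.sum_nonneg fun j _ => Set.indicator_nonneg (fun _ _ => zero_le_one) _)]
  ring

lemma support_cosetMeasure [MeasurableSingletonClass G] [TopologicalSpace G] [T1Space G] {J : Subgroup G} [Fintype J] {x : G} :
    (cosetMeasure J x).support = (fun j => x * j) '' (J : Set G) := by
  have hfin : ((fun j => x * j) '' (J : Set G)).Finite := (J : Set G).toFinite.image _
  ext y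
  simp only [Measure.mem_support_iff_forall, cosetMeasure_pos_iff]
  constructor
  · intro h
    rw [← hfin.isClosed.closure_eq, mem_closure_iff_nhds]
    intro U hU
    obtain ⟨j, hj, hjU⟩ := h U hU
    exact ⟨_, hjU, j, hj, rfl⟩
  · rintro ⟨j, hj, rfl⟩ U hU
    exact ⟨j, hj, mem_of_mem_nhds hU⟩

variable [MeasurableMul G] [StandardBorelSpace G] {Φ : G →* G} {μ : Measure G}
  [IsProbabilityMeasure μ]

lemma fibreMeasure_ae_eq_cosetMeasure (hΦ : Measurable Φ) (hr : MeasurableSet (Set.range Φ))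
    (hK : (Φ.ker : Set G).Finite) {S : G → G} (hS : Ergodic S μ)
    (hmul : ∀ x y, S (x * y) = S x * S y) (hfix : ∀ k ∈ Φ.ker, S k = k)
    [Fintype (kerStabilizer Φ μ)] :
    ∀ᵐ x ∂μ, fibreMeasure Φ μ x = cosetMeasure (kerStabilizer Φ μ) x := by
  have : ∀ x, IsProbabilityMeasure (fibreMeasure Φ μ x) := fun x => by
    unfold fibreMeasure; infer_instance
  refine ae_eq_of_forall_measurableSet fun s hs => ?_
  filter_upwards [condExpKernel_ae_eq_condExp (μ := μ) hΦ.comap_le hs,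
    condExp_comap_eq_average hΦ hr hK hS hmul hfix hs] with x h1 h2
  rw [← measureReal_eq_measureReal_iff, cosetMeasure_real_apply, ← h2, ← h1]
  rfl

lemma fibreAtoms_eq_of_fibreMeasure_eq [Fintype (kerStabilizer Φ μ)] {x : G}
    (h : fibreMeasure Φ μ x = cosetMeasure (kerStabilizer Φ μ) x) :
    fibreAtoms Φ μ x = (fun j => x * j) '' (kerStabilizer Φ μ : Set G) := by
  ext y
  constructor
  · rintro ⟨hy, hpos⟩
    rw [fibreMeasure_congr hy, h, cosetMeasure_pos_iff] at hpos
    exact hpos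
  · rintro ⟨j, hj, rfl⟩
    have hy : Φ (x * j) = Φ x := map_mul_of_mem_ker hj.1
    refine ⟨hy, ?_⟩
    rw [fibreMeasure_congr hy, h, cosetMeasure_pos_iff]
    exact ⟨j, hj, rfl⟩

/-- The conditional entropy given `Φ` of a partition that separates the points of each fibre. -/
lemma integral_sum_negMulLog_condExp_comap {β : Type*} [Fintype β] [MeasurableSpace β]
    [MeasurableSingletonClass β] (hΦ : Measurable Φ)
    (hr : MeasurableSet (Set.range Φ)) (hK : (Φ.ker : Set G).Finite) {S : G → G}
    (hS : Ergodic S μ) (hmul : ∀ x y, S (x * y) = S x * S y) (hfix : ∀ k ∈ Φ.ker, S k = k)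
    {g : G → β} (hg : Measurable g) (hinj : ∀ x y, Φ x = Φ y → g x = g y → x = y) :
    ∫ x, ∑ i, Real.negMulLog ((μ[(g ⁻¹' {i}).indicator (fun _ => (1 : ℝ)) |
      MeasurableSpace.comap Φ inferInstance]) x) ∂μ = Real.log (Nat.card (kerStabilizer Φ μ)) := by
  have : Fintype (kerStabilizer Φ μ) := (hK.subset kerStabilizer_le_ker).fintype
  have hcard : (Fintype.card (kerStabilizer Φ μ) : ℝ) ≠ 0 := Nat.cast_ne_zero.2 Fintype.card_ne_zero
  rw [Nat.card_eq_fintype_card]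
  set N : ℝ := ((Fintype.card (kerStabilizer Φ μ) : ℕ) : ℝ) with hN
  have key : ∀ᵐ x ∂μ, ∑ i, Real.negMulLog ((μ[(g ⁻¹' {i}).indicator (fun _ => (1 : ℝ)) |
      MeasurableSpace.comap Φ inferInstance]) x) = Real.log N := by
    filter_upwards [ae_all_iff.2 fun i => condExp_comap_eq_average hΦ hr hK hS hmul hfix
      (hg (measurableSet_singleton i))] with x hx
    -- Since `g` is injective on fibres, a cell holds at most one point of `x J`. The conditional
    -- probability is thus `0` or `1 / N`, where `negMulLog` is linear in the count.
    have hi : ∀ i : β, Real.negMulLog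
        ((∑ j : kerStabilizer Φ μ, (g ⁻¹' {i}).indicator (fun _ => (1 : ℝ)) (x * j)) / N) =
        (∑ j : kerStabilizer Φ μ, (g ⁻¹' {i}).indicator (fun _ => (1 : ℝ)) (x * j)) *
          (Real.log N / N) := by
      intro i
      by_cases hex : ∃ j : kerStabilizer Φ μ, g (x * j) = i
      · obtain ⟨j, hj⟩ := hex
        have : ∑ j : kerStabilizer Φ μ, (g ⁻¹' {i}).indicator (fun _ => (1 : ℝ)) (x * j) = 1 := by
          rw [Finset.sum_eq_single j]
          · simp [hj]
          · intro b _ hb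
            refine Set.indicator_of_notMem (fun h => hb ?_) _
            have := hinj (x * b) (x * j)
              ((map_mul_of_mem_ker b.2.1).trans (map_mul_of_mem_ker j.2.1).symm)
              ((show g (x * b) = i from h).trans hj.symm)
            exact Subtype.ext (mul_left_cancel this)
          · simp
        rw [this, Real.negMulLog, one_div, Real.log_inv]
        ring
      · have : ∑ j : kerStabilizer Φ μ, (g ⁻¹' {i}).indicator (fun _ => (1 : ℝ)) (x * j) = 0 :=
          Finset.sum_eq_zero fun j _ =>
            Set.indicator_of_notMem (s := g ⁻¹' {i}) (fun h => hex ⟨j, h⟩) _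
        rw [this]; simp
    rw [Finset.sum_congr rfl fun i _ => (congrArg Real.negMulLog (hx i)).trans (hi i), ← Finset.sum_mul, Finset.sum_comm]
    have hj : ∀ j : kerStabilizer Φ μ,
        ∑ i, (g ⁻¹' {i}).indicator (fun _ => (1 : ℝ)) (x * j) = 1 := by
      intro j
      rw [Finset.sum_eq_single (g (x * j))]
      · simp
      · intro b _ hb
        exact Set.indicator_of_notMem (s := g ⁻¹' {b}) (fun h => hb (Eq.symm h)) _
      · simp
    simp_rw [hj]
    rw [Finset.sum_const, Finset.card_univ, nsmul_eq_mul, mul_one, ← hN]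
    field_simp
  rw [integral_congr_ae key]
  simp

end Endomorphism

open scoped Topology

lemma continuous_ofLocalRule {A : Type*} [Finite A] [TopologicalSpace A] [DiscreteTopology A]
    (ℓ r : ℕ) (φ : (Fin (ℓ + r + 1) → A) → A) : Continuous (ofLocalRule ℓ r φ) :=
  continuous_pi fun _ => (continuous_of_discreteTopology (f := φ)).comp
    (continuous_pi fun _ => continuous_apply _)

lemma exists_iterate_eq_self_of_finite {X : Type*} {T : X → X} (hT : Function.Injective T)
    {K : Set X} (hK : K.Finite) (hTK : Set.MapsTo T K K) :
    ∃ n, 1 ≤ n ∧ ∀ k ∈ K, T^[n] k = k := by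
  have : Finite K := hK
  let e : Equiv.Perm K := Equiv.ofBijective (hTK.restrict T K K)
    (Finite.injective_iff_bijective.1 (hTK.restrict_inj.2 hT.injOn))
  refine ⟨orderOf e, orderOf_pos e, fun k hk => ?_⟩
  have h1 : (hTK.restrict T K K)^[orderOf e] = id := by
    have := congrArg (fun σ : Equiv.Perm K => (σ : K → K)) (pow_orderOf_eq_one e)
    rwa [← Equiv.Perm.iterate_eq_pow] at this
  have h2 := congrArg Subtype.val (congrFun h1 ⟨k, hk⟩)
  rwa [hTK.iterate_restrict] at h2

/-- Linear growth from convergence of the increments along an arithmetic progression. -/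
lemma tendsto_div_of_tendsto_sub {B : ℕ → ℝ} {w : ℕ} {c : ℝ}
    (h : Tendsto (fun m => B (m + w) - B m) atTop (𝓝 c)) (M : ℕ) :
    Tendsto (fun n : ℕ => B (M + n * w) / n) atTop (𝓝 c) := by
  have hu : Tendsto (fun n : ℕ => B (M + (n + 1) * w) - B (M + n * w)) atTop (𝓝 c) := by
    -- The case `w = 0` occurs for `ℓ = r = 0`: the progression is constant and all increments
    -- vanish.
    rcases Nat.eq_zero_or_pos w with rfl | hw
    · simpa using h
    · have ht : Tendsto (fun n : ℕ => M + n * w) atTop atTop :=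
        tendsto_atTop_mono (fun n => (Nat.le_mul_of_pos_right n hw).trans (Nat.le_add_left _ _))
          tendsto_id
      refine (h.comp ht).congr fun n => ?_
      simp only [Function.comp]
      rw [show M + n * w + w = M + (n + 1) * w by ring]
  have hs : ∀ n : ℕ, ∑ i ∈ Finset.range n, (B (M + (i + 1) * w) - B (M + i * w)) =
      B (M + n * w) - B M := fun n => by
    rw [Finset.sum_range_sub fun i => B (M + i * w)]; simp
  have h1 := hu.cesaro
  simp_rw [hs] at h1
  have h2 : Tendsto (fun n : ℕ => B M / n) atTop (𝓝 0) := tendsto_const_div_atTop_nhds_zero_nat _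
  have h3 := h1.add h2
  rw [add_zero] at h3
  refine h3.congr fun n => ?_
  ring

/-! ### Kolmogorov–Sinai entropy from word entropies -/

section Entropy

variable {A : Type*} [Fintype A] [MeasurableSpace A] [MeasurableSingletonClass A]
  {ℓ r : ℕ} {φ : (Fin (ℓ + r + 1) → A) → A} {μ : Measure (ℤ → A)} [IsProbabilityMeasure μ]

/-- The entropy of a longer word is the entropy of a word of the image plus a conditional
entropy. -/
lemma partitionEntropy_word_prod (hL : LeftPermutative φ) (hR : RightPermutative φ)
    (hΦ : MeasurePreserving (ofLocalRule ℓ r φ) μ μ) (hσ : MeasurePreserving shift μ μ) (m : ℕ) :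
    partitionEntropy μ (fun x => (word (-(ℓ : ℤ)) (ℓ + r) x, centredWord m (ofLocalRule ℓ r φ x))) =
      partitionEntropy μ (word 0 (m + (ℓ + r)) : (ℤ → A) → _) := by
  rw [← partitionEntropy_word hσ (-((m / 2 : ℕ) : ℤ) - ℓ)]
  refine partitionEntropy_congr
    ((measurable_word _ _).prodMk ((measurable_word _ _).comp hΦ.measurable))
    (measurable_word _ _) fun x y => ?_
  simp only [Prod.mk.injEq, centredWord, word_eq_iff]
  constructor
  · rintro ⟨h1, h2⟩ z hz1 hz2
    exact eq_of_image_eq hL hR (a := -((m / 2 : ℕ) : ℤ)) (b := -((m / 2 : ℕ) : ℤ) + m)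
      (by omega) (by omega) (fun z h3 h4 => h1 z h3 (by push_cast; omega)) h2 z hz1
      (by push_cast at hz2; omega)
  · intro h
    refine ⟨fun z h1 h2 => h z (by omega) (by push_cast at h2 ⊢; omega), ?_⟩
    exact image_eq_of_eq fun z h1 h2 => h z h1 (by push_cast; omega)

/-- The difference is the conditional entropy of the central word given an image word of length `m`.
The σ-algebras of the image words increase to `Φ⁻¹(𝔅)`. -/
lemma tendsto_partitionEntropy_word_sub (hL : LeftPermutative φ) (hR : RightPermutative φ)
    (hΦ : MeasurePreserving (ofLocalRule ℓ r φ) μ μ) (hσ : MeasurePreserving shift μ μ) :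
    Tendsto (fun m => partitionEntropy μ (word 0 (m + (ℓ + r)) : (ℤ → A) → _) -
      partitionEntropy μ (word 0 m : (ℤ → A) → _)) atTop
      (𝓝 (∫ x, ∑ i, Real.negMulLog ((μ[(word (-(ℓ : ℤ)) (ℓ + r) ⁻¹' {i}).indicator
        (fun _ => (1 : ℝ)) | MeasurableSpace.comap (ofLocalRule ℓ r φ) inferInstance]) x) ∂μ)) := by
  have hcomap : ∀ m, MeasurableSpace.comap (fun x => centredWord m (ofLocalRule ℓ r φ x))
      inferInstance = MeasurableSpace.comap (ofLocalRule ℓ r φ)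
        (MeasurableSpace.comap (centredWord m) inferInstance) := fun m =>
    MeasurableSpace.comap_comp.symm
  have h := tendsto_partitionEntropy_prod_sub (μ := μ)
    (f := fun m x => centredWord m (ofLocalRule ℓ r φ x))
    (fun m => (measurable_word _ _).comp hΦ.measurable)
    (measurable_word (A := A) (-(ℓ : ℤ)) (ℓ + r)) (by
      simp_rw [hcomap]
      exact fun m n h => MeasurableSpace.comap_mono (monotone_comap_centredWord h))
  simp_rw [hcomap] at h
  rw [← MeasurableSpace.comap_iSup, iSup_comap_centredWord] at h
  refine h.congr fun m => ?_
  rw [partitionEntropy_word_prod hL hR hΦ hσ, partitionEntropy_comp hΦ (measurable_centredWord m),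
    centredWord, partitionEntropy_word hσ (-((m / 2 : ℕ) : ℤ))]

/-- The itinerary of `centredWord M` up to time `n` is a function of a word of length `M + n (ℓ +
r)`, so it has entropy rate at most `c`. Passing to `f` costs `d M`, which tends to `0` because
words generate the σ-algebra. -/
lemma entropyOfPartition_le {c : ℝ}
    (hΦ : MeasurePreserving (ofLocalRule ℓ r φ) μ μ) (hσ : MeasurePreserving shift μ μ)
    (hc : Tendsto (fun m => partitionEntropy μ (word 0 (m + (ℓ + r)) : (ℤ → A) → _) -
      partitionEntropy μ (word 0 m : (ℤ → A) → _)) atTop (𝓝 c))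
    {ι : Type*} [Fintype ι] [MeasurableSpace ι] [MeasurableSingletonClass ι]
    {f : (ℤ → A) → ι} (hf : Measurable f) :
    entropyOfPartition (ofLocalRule ℓ r φ) μ f ≤ (c : EReal) := by
  let d : ℕ → ℝ := fun M =>
    partitionEntropy μ (fun x => (f x, centredWord M x)) - partitionEntropy μ (centredWord M)
  have hd : Tendsto d atTop (𝓝 0) := by
    have h := tendsto_partitionEntropy_prod_sub (μ := μ) (f := fun m => centredWord (A := A) m)
      measurable_centredWord hf monotone_comap_centredWord
    rw [iSup_comap_centredWord] at h
    convert h using 2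
    symm
    refine integral_eq_zero_of_ae (Eventually.of_forall fun x => Finset.sum_eq_zero fun j _ => ?_)
    rw [condExp_of_stronglyMeasurable le_rfl
      (stronglyMeasurable_const.indicator (hf (measurableSet_singleton j)))
      ((integrable_const (1 : ℝ)).indicator (hf (measurableSet_singleton j)))]
    by_cases hx : x ∈ f ⁻¹' {j}
    · rw [Set.indicator_of_mem hx, Real.negMulLog_one]
    · rw [Set.indicator_of_notMem hx, Real.negMulLog_zero]
  have hM : ∀ M, entropyOfPartition (ofLocalRule ℓ r φ) μ f ≤ ((c + d M : ℝ) : EReal) := by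
    intro M
    have hlim := (tendsto_div_of_tendsto_sub
      (B := fun m => partitionEntropy μ (word 0 m : (ℤ → A) → _)) (w := ℓ + r) hc M).add_const (d M)
    have hlim' := (continuous_coe_real_ereal.tendsto _).comp hlim
    rw [← hlim'.limsup_eq, entropyOfPartition]
    refine limsup_le_limsup ?_
    filter_upwards [eventually_ge_atTop 1] with n hn
    refine EReal.coe_le_coe_iff.2 ?_
    have hn0 : (0 : ℝ) < n := by exact_mod_cast hn
    have h1 := partitionEntropy_itinerary_le hΦ hf
      (measurable_centredWord (A := A) M) n
    have h2 : partitionEntropy μ (itinerary (ofLocalRule ℓ r φ) (centredWord M) n) ≤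
        partitionEntropy μ (word 0 (M + n * (ℓ + r)) : (ℤ → A) → _) := by
      rw [← partitionEntropy_word hσ (-((M / 2 : ℕ) : ℤ) - n * ℓ)]
      refine partitionEntropy_mono (measurable_word _ _)
        (measurable_itinerary hΦ.measurable (measurable_centredWord M) n) fun x y h => ?_
      rw [word_eq_iff] at h
      rw [itinerary_eq_iff]
      intro t ht
      rw [centredWord, word_eq_iff]
      have e1 : (t : ℤ) * ℓ ≤ n * ℓ := by gcongr
      have e2 : (t : ℤ) * r ≤ n * r := by gcongr
      refine iterate_eq_of_eq t fun z h1 h2 => h z (by linarith) ?_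
      rw [Nat.cast_add, Nat.cast_mul, Nat.cast_add]
      linarith
    change _ ≤ _ + (n : ℝ) * d M at h1
    rw [div_le_iff₀ hn0, add_mul, div_mul_cancel₀ _ hn0.ne']
    linarith [mul_comm (n : ℝ) (d M)]
  have hlim : Tendsto (fun M => ((c + d M : ℝ) : EReal)) atTop (𝓝 (c : EReal)) := by
    have := hd.const_add c
    rw [add_zero] at this
    exact (continuous_coe_real_ereal.tendsto _).comp this
  exact ge_of_tendsto' hlim hM

/-- By `eq_of_iterate_eq`, the itinerary up to time `n` determines a word of length `n (ℓ + r)`,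
whose entropy grows like `n c`. -/
lemma le_entropyOfPartition (hL : LeftPermutative φ) (hR : RightPermutative φ) {c : ℝ}
    (hΦ : MeasurePreserving (ofLocalRule ℓ r φ) μ μ) (hσ : MeasurePreserving shift μ μ)
    (hc : Tendsto (fun m => partitionEntropy μ (word 0 (m + (ℓ + r)) : (ℤ → A) → _) -
      partitionEntropy μ (word 0 m : (ℤ → A) → _)) atTop (𝓝 c))
    {ι : Type*} [Fintype ι] [MeasurableSpace ι] [MeasurableSingletonClass ι]
    {f : (ℤ → A) → ι} (hf : Measurable f)
    (hfw : ∀ x y, f x = f y → word (-(ℓ : ℤ)) (ℓ + r) x = word (-(ℓ : ℤ)) (ℓ + r) y) :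
    (c : EReal) ≤ entropyOfPartition (ofLocalRule ℓ r φ) μ f := by
  have hlim := (continuous_coe_real_ereal.tendsto _).comp (tendsto_div_of_tendsto_sub
      (B := fun m => partitionEntropy μ (word 0 m : (ℤ → A) → _)) (w := ℓ + r) hc 0)
  rw [← hlim.limsup_eq, entropyOfPartition]
  refine limsup_le_limsup (Eventually.of_forall fun n => EReal.coe_le_coe_iff.2 ?_)
  refine div_le_div_of_nonneg_right ?_ n.cast_nonneg
  rw [← partitionEntropy_word hσ (-(n * ℓ : ℤ))]
  refine partitionEntropy_mono (measurable_itinerary hΦ.measurable hf n) (measurable_word _ _)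
    fun x y h => ?_
  rw [itinerary_eq_iff] at h
  rw [word_eq_iff]
  intro z h1 h2
  refine eq_of_iterate_eq hL hR n (fun t ht z h3 h4 => ?_) z h1 (by push_cast at h2; linarith)
  exact word_eq_iff.1 (hfw _ _ (h t ht)) z h3 (by push_cast; linarith)

lemma entropy_ofLocalRule (hL : LeftPermutative φ) (hR : RightPermutative φ) {c : ℝ}
    (hΦ : MeasurePreserving (ofLocalRule ℓ r φ) μ μ) (hσ : MeasurePreserving shift μ μ)
    (hc : Tendsto (fun m => partitionEntropy μ (word 0 (m + (ℓ + r)) : (ℤ → A) → _) -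
      partitionEntropy μ (word 0 m : (ℤ → A) → _)) atTop (𝓝 c)) :
    entropy (ofLocalRule ℓ r φ) μ = (c : EReal) := by
  refine le_antisymm
    (iSup_le fun k => iSup_le fun f => iSup_le fun hf => entropyOfPartition_le hΦ hσ hc hf) ?_
  classical
  let e := Fintype.equivFin (Fin (ℓ + r) → A)
  have hf : Measurable fun x : ℤ → A => e (word (-(ℓ : ℤ)) (ℓ + r) x) :=
    (measurable_of_finite e).comp (measurable_word _ _)
  refine le_trans ?_ (le_iSup_of_le _ (le_iSup_of_le _ (le_iSup_of_le hf le_rfl)))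
  exact le_entropyOfPartition hL hR hΦ hσ hc hf fun x y h => e.injective h

end Entropy

lemma finite_ker_of_bipermutative {A : Type*} [Finite A] [Group (ℤ → A)] {ℓ r : ℕ}
    {φ : (Fin (ℓ + r + 1) → A) → A} (hL : LeftPermutative φ) (hR : RightPermutative φ)
    {Φ : (ℤ → A) →* (ℤ → A)} (hΦ : ⇑Φ = ofLocalRule ℓ r φ) :
    (Φ.ker : Set (ℤ → A)).Finite := by
  refine Set.Finite.of_finite_image (f := word (-(ℓ : ℤ)) (ℓ + r)) (Set.toFinite _) ?_
  intro x hx y hy h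
  refine eq_of_image_eq_of_word_eq hL hR ?_ h
  rw [← hΦ, MonoidHom.mem_ker.1 hx, MonoidHom.mem_ker.1 hy]

end BipermCA

open BipermCA in
theorem mainTheorem5 {A : Type*} [Finite A] [TopologicalSpace A] [DiscreteTopology A]
    [MeasurableSpace A] [DiscreteMeasurableSpace A] [Group (ℤ → A)]
    (hA : BipermCA.IsGroupShift A)
    (Φ : (ℤ → A) →* (ℤ → A)) (hΦ : BipermCA.IsBipermutativeCA Φ)
    (μ : Measure (ℤ → A)) [IsProbabilityMeasure μ]
    (hμΦ : MeasurePreserving Φ μ μ) (hμσ : BipermCA.TotallyErgodic BipermCA.shift μ) :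
    ∃ J : Subgroup (ℤ → A),
      J ≤ Φ.ker ∧
      (BipermCA.shift ⁻¹' (J : Set (ℤ → A)) = (J : Set (ℤ → A))) ∧
      (J : Set (ℤ → A)).Finite ∧
      (∀ᵐ x ∂μ, BipermCA.fibreAtoms Φ μ x = (fun j => x * j) '' (J : Set (ℤ → A)) ∧
        (BipermCA.fibreMeasure Φ μ x).support = (fun j => x * j) '' (J : Set (ℤ → A))) ∧
      BipermCA.entropy Φ μ = ((Real.log (Nat.card J) : ℝ) : EReal) ∧
      BipermCA.IsAEToOne Φ μ (Nat.card J) := by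
  cases nonempty_fintype A
  have := hA.isTopologicalGroup
  have : MeasurableMul (ℤ → A) := inferInstance
  obtain ⟨ℓ, r, φ, hφ, hL, hR⟩ := hΦ
  have hσ : MeasurePreserving shift μ μ := (hμσ 1 le_rfl).toMeasurePreserving
  have hK := finite_ker_of_bipermutative hL hR hφ
  have hr : MeasurableSet (Set.range Φ) := by
    rw [hφ]
    exact (isCompact_range (continuous_ofLocalRule ℓ r φ)).isClosed.measurableSet
  have hcomm : ∀ x, Φ (shift x) = shift (Φ x) := fun x => by rw [hφ, shift_ofLocalRule]
  have hone : shift (1 : ℤ → A) = 1 := by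
    have h := hA.shift_mul 1 1
    rw [mul_one] at h
    exact left_eq_mul.1 h
  have hshK : Set.MapsTo shift (Φ.ker : Set (ℤ → A)) Φ.ker := fun k hk => by
    change Φ (shift k) = 1
    rw [hcomm, MonoidHom.mem_ker.1 hk, hone]
  -- Total ergodicity is needed for this exponent: the shift itself may move kernel elements.
  obtain ⟨n, hn, hfix⟩ := exists_iterate_eq_self_of_finite shift_injective hK hshK
  have hS : Ergodic (shift^[n]) μ := hμσ n hn
  have hmul : ∀ x y : ℤ → A, shift^[n] (x * y) = shift^[n] x * shift^[n] y := fun x y => by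
    simpa using iterate_map_mul (MulHom.mk shift hA.shift_mul) n x y
  have hJK : (kerStabilizer Φ μ : Set (ℤ → A)).Finite := hK.subset kerStabilizer_le_ker
  have : Fintype (kerStabilizer Φ μ) := hJK.fintype
  refine ⟨kerStabilizer Φ μ, kerStabilizer_le_ker, ?_, hJK, ?_, ?_,
    isAEToOne_card_kerStabilizer hμΦ hr hK hS hmul hfix⟩
  -- The shift intertwines translation by `k` with translation by `shift k`, so it maps the
  -- stabilizer into itself. Finiteness and injectivity upgrade the inclusion to equality.
  · have hsub : shift '' (kerStabilizer Φ μ : Set (ℤ → A)) ⊆ kerStabilizer Φ μ := by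
      rintro _ ⟨k, hk, rfl⟩
      refine ⟨hshK hk.1, ?_⟩
      have h : (fun x : ℤ → A => x * shift k) ∘ shift = shift ∘ (· * k) := by
        ext1 x; exact (hA.shift_mul x k).symm
      conv_lhs => rw [← hσ.map_eq]
      rw [Measure.map_map (measurable_mul_const _) hσ.measurable, h,
        ← Measure.map_map hσ.measurable (measurable_mul_const k), hk.2, hσ.map_eq]
    have heq := Set.eq_of_subset_of_ncard_le hsub
      (Set.ncard_image_of_injective _ shift_injective).ge hJK
    conv_lhs => rw [← heq]
    exact Set.preimage_image_eq _ shift_injective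
  · filter_upwards [fibreMeasure_ae_eq_cosetMeasure hμΦ.measurable hr hK hS hmul hfix] with x hx
    refine ⟨fibreAtoms_eq_of_fibreMeasure_eq hx, ?_⟩
    rw [hx, support_cosetMeasure]
  · have hc := integral_sum_negMulLog_condExp_comap hμΦ.measurable hr hK hS hmul hfix
      (measurable_word (A := A) (-(ℓ : ℤ)) (ℓ + r)) fun x y h1 h2 =>
        eq_of_image_eq_of_word_eq hL hR (hφ ▸ h1) h2
    rw [← hc]
    rw [hφ] at hμΦ ⊢
    exact entropy_ofLocalRule hL hR hμΦ hσ (tendsto_partitionEntropy_word_sub hL hR hμΦ hσ)
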